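/- **Conventions.** A complex tensor $\mathcal T=(t_{i_1\cdots i_k})$ of order $k$ and dimension $n$ has indices in $[n]=\{1,\dots,n\}$. Its $d$-th order trace is $$\mathrm{Tr}_d(\mathcal T)=(k-1)^{n-1}\sum_{d_1+\cdots+d_n=d}\ \prod_{i=1}^n\frac{1}{(d_i(k-1))!}\Bigl(\sum_{\beta\in[n]^{k-1}}t_{i\beta}\frac{\partial}{\partial a_{i\beta}}\Bigr)^{d_i}\mathrm{tr}\bigl(A^{d(k-1)}\bigr),$$ where $A=(a_{ij})$ is an $n\times n$ matrix of indeterminates, the $d_i$ are nonnegative integers, and $\frac{\partial}{\partial a_{i\beta}}=\frac{\partial}{\partial a_{ii_2}}\cdots\frac{\partial}{\partial a_{ii_k}}$ for $\beta=i_2\cdots i_k$. Let $\mathcal H$ be a $k$-uniform hypergraph with vertex set $[n]$, $n\ge 1$, hyperedge set $E(\mathcal H)$ and vertex degrees $d_1,\dots,d_n$. Its adjacency tensor $\mathcal A(\mathcal H)$ has the entry $\frac1{(k-1)!}$ at $i_1\cdots i_k$ if $\{i_1,\dots,i_k\}\in E(\mathcal H)$, and $0$ otherwise. $\mathcal D(\mathcal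 H)$ is the diagonal tensor of the degrees, and $\mathcal A_\alpha(\mathcal H)=\alpha\mathcal D(\mathcal H)+(1-\alpha)\mathcal A(\mathcal H)$. Put $\phi(s)=(k-1)^{n-1}\alpha^s\sum_{i=1}^n d_i^s$. Let $\mathcal K_{k+1}$ be the set of all complete $k$-uniform subhypergraphs of $\mathcal H$ with exactly $k+1$ hyperedges. For a sequence $f=(i_1\beta_1,\dots,i_d\beta_d)$ with $i_1\le\cdots\le i_d$ in $[n]$ and $\beta_j=i_{j2}\cdots i_{jk}\in[n]^{k-1}$, let $D_f$ be the multi-digraph whose arcs, counted with multiplicity, are $(i_j,i_{jl})$ for $1\le j\le d$, $2\le l\le k$, and whose vertices are the ends of these arcs. Let $\mathcal H_f$ be the multi-hypergraph with the vertices of $D_f$ and the hyperedges, counted with multiplicity, $\{i_j,i_{j2},\dots,i_{jk}\}$ for those $j$ for which these $k$ indices are distinct. For $\mathcal G\in\mathcal K_{k+1}$ let $\mathcal F_{k+2}(\mathcal G)$ be the set of such sequences $f$ of length $d=k+2$ for which $\mathcal H_f=\mathcal G$ and $D_f$ has an Euler tour. Let $R(\mathcal G)$ be the set of the distinct (labelled)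 multi-digraphs obtained from the $D_f$, $f\in\mathcal F_{k+2}(\mathcal G)$, by removing all loops. For $D\in R(\mathcal G)$ let $\tau(D)$ be the number of spanning trees of $D$ rooted at, and directed towards, a specified vertex of $D$, which may be chosen arbitrarily for each $\mathcal G$ and $D$. **Theorem.** Let $k\ge2$, let $\mathcal H$ be a $k$-uniform hypergraph with degree sequence $d_1,\dots,d_n$, and let $0\le\alpha\le1$. Then, for every choice of the roots, $$\begin{aligned} \mathrm{Tr}_{k+2}(\mathcal A_\alpha(\mathcal H))={}&\phi(k+2)+(1-\alpha)^{k+2}\,\mathrm{Tr}_{k+2}(\mathcal A(\mathcal H))\\ &+(k+2)(k-1)^{n-k}k^{k-2}\alpha^2(1-\alpha)^k\sum_{e\in E(\mathcal H)}\Bigl(\sum_{\{i,j\}\subset e}d_id_j+\sum_{i\in e}d_i^2\Bigr)\\ &+(k+2)(k-1)^{n-k-1}\alpha(1-\alpha)^{k+1}\sum_{\mathcal G\in\mathcal K_{k+1}}\Bigl(\sum_{D\in R(\mathcal G)}\tau(D)\Bigr)\Bigl(\sum_{i\in V(\mathcal G)}d_i\Bigr), \end{aligned}$$ where $\sum_{\{i,j\}\subset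 e}$ runs over the unordered pairs of distinct vertices $i\neq j$ of $e$ (the pair may be all of $e$ when $k=2$). -/

import Mathlib

namespace HyperMoment

open Finset

/-! ### Tensors and their traces -/

/-- `k`-order `n`-dimensional complex tensors. The `k`-tuple of indices `i i₂ ⋯ i_k` is written
as the first index `i` followed by the `(k-1)`-tuple `i₂ ⋯ i_k`. -/
abbrev Tensor (k n : ℕ) : Type := Fin n → (Fin (k - 1) → Fin n) → ℂ

/-- Polynomials in the entries `a_{ij}` of an auxiliary `n × n` matrix. -/
abbrev AuxPoly (n : ℕ) : Type := MvPolynomial (Fin n × Fin n) ℂ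

/-- The differential operator `∂/∂a_{iβ} = ∂/∂a_{i i₂} ⋯ ∂/∂a_{i i_k}`, where `β = i₂ ⋯ i_k`. -/
noncomputable def partialOp {k n : ℕ} (i : Fin n) (β : Fin (k - 1) → Fin n) :
    Module.End ℂ (AuxPoly n) :=
  (List.ofFn fun l : Fin (k - 1) =>
    ((MvPolynomial.pderiv (R := ℂ) (i, β l)).toLinearMap : Module.End ℂ (AuxPoly n))).prod

/-- The operator `∑_β T_{iβ} ∂/∂a_{iβ}`, the sum being over all `β ∈ [n]^{k-1}`. -/
noncomputable def rowOp {k n : ℕ} (T : Tensor k n) (i : Fin n) : Module.End ℂ (AuxPoly n) :=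
  ∑ β : Fin (k - 1) → Fin n, T i β • partialOp i β

/-- The `d`-th order trace of a tensor,
`(k-1)^{n-1} ∑_{d_1+⋯+d_n=d} ∏_i (1/(d_i(k-1))!) (∑_β T_{iβ} ∂/∂a_{iβ})^{d_i} tr(A^{d(k-1)})`.
The polynomial `tr(A^{d(k-1)})` is homogeneous of degree `d(k-1)` and is differentiated `d(k-1)`
times, so the result is a constant polynomial, which `constantCoeff` turns into a number. -/
noncomputable def tensorTrace {k n : ℕ} (d : ℕ) (T : Tensor k n) : ℂ :=
  ((k : ℂ) - 1) ^ ((n : ℤ) - 1) *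
    ∑ c ∈ Finset.piAntidiag (Finset.univ : Finset (Fin n)) d,
      MvPolynomial.constantCoeff
        ((List.ofFn fun i : Fin n =>
            (((Nat.factorial (c i * (k - 1)) : ℕ) : ℂ)⁻¹) • rowOp T i ^ c i).prod
          (Matrix.trace (Matrix.mvPolynomialX (Fin n) (Fin n) ℂ ^ (d * (k - 1)))))

/-! ### Hypergraphs and their tensors -/

/-- `H` is a `k`-uniform hypergraph with vertex set `[n]`. -/
def IsUniformOn {n : ℕ} (k : ℕ) (H : Hypergraph (Fin n)) : Prop :=
  H.vertexSet = Set.univ ∧ ∀ e ∈ H.edgeSet, e.ncard = k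

open Classical in
/-- The hyperedges of `H`, as a finset of finsets. -/
noncomputable def edges {n : ℕ} (H : Hypergraph (Fin n)) : Finset (Finset (Fin n)) :=
  Finset.univ.filter fun e => (e : Set (Fin n)) ∈ H.edgeSet

/-- The degree of a vertex: the number of hyperedges that contain it. -/
noncomputable def deg {n : ℕ} (H : Hypergraph (Fin n)) (v : Fin n) : ℕ :=
  ((edges H).filter fun e => v ∈ e).card

/-- The set of the indices that occur in the index tuple `i β`. -/
def indexSet {k n : ℕ} (i : Fin n) (β : Fin (k - 1) → Fin n) : Finset (Fin n) :=
  insert i (Finset.univ.image β)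

/-- The adjacency tensor. -/
noncomputable def adjTensor (k : ℕ) {n : ℕ} (H : Hypergraph (Fin n)) : Tensor k n :=
  fun i β => if indexSet i β ∈ edges H then ((Nat.factorial (k - 1) : ℕ) : ℂ)⁻¹ else 0

/-- The degree tensor: the diagonal tensor of the vertex degrees. -/
noncomputable def degTensor (k : ℕ) {n : ℕ} (H : Hypergraph (Fin n)) : Tensor k n :=
  fun i β => if ∀ l, β l = i then (deg H i : ℂ) else 0

/-- The `A_α`-tensor `α D(H) + (1 - α) A(H)`. -/
noncomputable def alphaTensor (k : ℕ) {n : ℕ} (α : ℝ) (H : Hypergraph (Fin n)) : Tensor k n :=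
  (α : ℂ) • degTensor k H + (1 - (α : ℂ)) • adjTensor k H

/-- `φ(s) = (k-1)^{n-1} α^s ∑_i d_i^s`. -/
noncomputable def phi (k : ℕ) {n : ℕ} (α : ℝ) (H : Hypergraph (Fin n)) (s : ℕ) : ℂ :=
  ((k : ℂ) - 1) ^ ((n : ℤ) - 1) * (α : ℂ) ^ s * ∑ i, (deg H i : ℂ) ^ s

/-- The complete `k`-uniform subhypergraphs of `H` with exactly `k + 1` hyperedges. Such a
subhypergraph `G` is recorded by its vertex set; its hyperedges are all the `k`-subsets of it. -/
noncomputable def completeSubs (k : ℕ) {n : ℕ} (H : Hypergraph (Fin n)) :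
    Finset (Finset (Fin n)) :=
  Finset.univ.filter fun G => G.powersetCard k ⊆ edges H ∧ (G.powersetCard k).card = k + 1

/-! ### Multi-digraphs -/

/-- A multi-digraph with vertices in `[n]`: `D u v` is the number of arcs from `u` to `v`. -/
abbrev MultiDigraph (n : ℕ) : Type := Fin n → Fin n → ℕ

/-- The vertices that are incident with an arc. -/
def verts {n : ℕ} (D : MultiDigraph n) : Finset (Fin n) :=
  Finset.univ.filter fun v => ∃ u, 0 < D u v ∨ 0 < D v u

/-- The arcs, parallel arcs being distinguished; `a.1.1` is the tail of `a`, `a.1.2` its head. -/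
abbrev Arc {n : ℕ} (D : MultiDigraph n) : Type := Σ p : Fin n × Fin n, Fin (D p.1 p.2)

/-- `w 0, w 1, …` is an Euler tour of `D`: a closed walk that uses every arc exactly once, hence
goes from `u` to `v` as many times as there are arcs from `u` to `v`. -/
def IsEulerTour {n : ℕ} (D : MultiDigraph n) (w : ℕ → Fin n) : Prop :=
  w (∑ u, ∑ v, D u v) = w 0 ∧
    ∀ u v, ((Finset.range (∑ x, ∑ y, D x y)).filter
      fun t => w t = u ∧ w (t + 1) = v).card = D u v

/-- `T` is the arc set of a spanning tree of `D` rooted at `r` (directed towards `r`): no arc of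
`T` leaves `r`, exactly one arc of `T` leaves each other vertex of `D`, and from each vertex of `D`
the arcs of `T` lead to `r`. -/
def IsRootedSpanningTree {n : ℕ} (D : MultiDigraph n) (r : Fin n) (T : Finset (Arc D)) : Prop :=
  (∀ a ∈ T, a.1.1 ≠ r) ∧
  (∀ v ∈ verts D, v ≠ r → ∃! a, a ∈ T ∧ a.1.1 = v) ∧
  ∀ v ∈ verts D, Relation.ReflTransGen (fun x y => ∃ a ∈ T, a.1.1 = x ∧ a.1.2 = y) v r

open Classical in
/-- `τ(D)`: the number of spanning trees of `D` rooted at `r`. -/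
noncomputable def tau {n : ℕ} (D : MultiDigraph n) (r : Fin n) : ℕ :=
  (Finset.univ.filter fun T : Finset (Arc D) => IsRootedSpanningTree D r T).card

/-- Removal of all loops. -/
def deleteLoops {n : ℕ} (D : MultiDigraph n) : MultiDigraph n :=
  fun u v => if u = v then 0 else D u v

/-! ### Sequences of index tuples -/

/-- Sequences `(i₁β₁, …, i_dβ_d)` of `d` index tuples in `[n]^k`. -/
abbrev IndexSeq (k n d : ℕ) : Type := Fin d → Fin n × (Fin (k - 1) → Fin n)

/-- The condition `i₁ ≤ ⋯ ≤ i_d` that defines the set `F_d`. -/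
def IsSorted {k n d : ℕ} (f : IndexSeq k n d) : Prop := Monotone fun j => (f j).1

/-- The multi-digraph `D(f)`: each entry `i_j i_{j2} ⋯ i_{jk}` of `f` contributes the arcs
`(i_j, i_{j2}), …, (i_j, i_{jk})`. -/
def digraphOf {k n d : ℕ} (f : IndexSeq k n d) : MultiDigraph n :=
  fun u v => (Finset.univ.filter
    fun p : Fin d × Fin (k - 1) => (f p.1).1 = u ∧ (f p.1).2 p.2 = v).card

/-- The hyperedges of the multi-hypergraph `H_f`, with multiplicity: the index sets of those
entries of `f` whose `k` indices are distinct. The vertex set of `H_f` is that of `D(f)`. -/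
def hyperedgesOf {k n d : ℕ} (f : IndexSeq k n d) : Multiset (Finset (Fin n)) :=
  ((Finset.univ.filter fun j => (indexSet (f j).1 (f j).2).card = k).val).map
    fun j => indexSet (f j).1 (f j).2

/-- `f` belongs to `F_d(G)`, where `G` is the complete `k`-uniform hypergraph on the given vertex
set: `f` is sorted, `H_f` is `G` (each hyperedge of multiplicity one), and the multi-digraph `D(f)`
has an Euler tour. -/
def MemF {k n d : ℕ} (G : Finset (Fin n)) (f : IndexSeq k n d) : Prop :=
  IsSorted f ∧ verts (digraphOf f) = G ∧ hyperedgesOf f = (G.powersetCard k).val ∧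
    ∃ w, IsEulerTour (digraphOf f) w

open Classical in
/-- `R(G)`: the multi-digraphs on the vertices of `G` that arise from the digraphs `D(f)` with
`f ∈ F_{k+2}(G)` by removing all loops. -/
noncomputable def loopFreeDigraphs (k : ℕ) {n : ℕ} (G : Finset (Fin n)) :
    Finset (MultiDigraph n) :=
  (Finset.univ.filter fun f : IndexSeq k n (k + 2) => MemF G f).image
    fun f => deleteLoops (digraphOf f)

end HyperMoment

/-! Replacing each $\partial/\partial a_{ij}$ by a variable turns the trace into a pairing of
$\mathrm{tr}(A^{d(k-1)})$ with a product of row polynomials (`tensorTrace_eq_pairing`). For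
$\mathcal A_\alpha$ the polynomial of row $i$ is $\alpha d_i x_{ii}^{k-1}+(1-\alpha)\sum_{e\ni
i}\prod_{v\in e\setminus i}x_{iv}$. A monomial with exponents $D$ is a multi-digraph, and its
pairing with the trace power counts the closed walks that use each labelled arc of $D$ once. The
digraphs that occur are unions of stars (one per hyperedge factor, spanning that hyperedge) together
with bundles of $k-1$ loops (one per diagonal factor).

A closed walk forces equal in- and out-degrees. For stars this says that a vertex that is the centre
of $t$ of them lies in exactly $kt$ of the chosen hyperedges
(`mul_card_eq_of_closedWalkCount_ne_zero`). Hence the number $b$ of stars is $0$ or at least $k$,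
and for $d=k+2$ only $b=0,k,k+1,k+2$ remain. For $b=0$ all loops must sit at one vertex, which gives
$\phi$; $b=k+2$ is the trace of the adjacency tensor. For $b=k$ and $b=k+1$ the centres are distinct
and form a set $S$, each vertex of $S$ is covered $k$ times, and no other vertex is covered. If
$|S|=k$, every chosen hyperedge is $S$ and the stars form the complete digraph on $S$. If $|S|=k+1$,
the chosen hyperedges are all the $k$-subsets of $S$, so $S$ spans a member of $\mathcal K_{k+1}$.

The walks are counted by the BEST theorem in determinant form (`closedWalkCount_eq`). Loops on $S$
leave the Laplacian unchanged, and their effect on the factorials is cancelled by the numerical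
factor of the trace (`rowFactor_mul_closedWalkCount`). So each distribution of the loops over $S$
has the same weight, and summing over them gives the complete homogeneous symmetric polynomial of
the degrees: $\sum d_id_j+\sum d_i^2$ for two diagonal factors, $\sum d_i$ for one. The determinant
is $k^{k-2}$ for the complete digraph (`det_lap_complete`). In the other case the determinants add
up to $\sum_{D\in R(\mathcal G)}\tau(D)$ by the matrix-tree theorem (`tau_eq_det_lap`) and the
identification of $R(\mathcal G)$ with the star families that have a spanning tree
(`sum_tau_loopFreeDigraphs`). -/

namespace HyperMoment

open Finset

/-! ### The differential pairing -/

section Pairing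

variable {σ : Type*} [Fintype σ]

/-- The product of the factorials of the exponents of a monomial. -/
def expFactorial (D : σ →₀ ℕ) : ℕ := ∏ x, (D x).factorial

theorem expFactorial_add_single (D : σ →₀ ℕ) (x : σ) :
    expFactorial (D + Finsupp.single x 1) = (D x + 1) * expFactorial D := by
  classical
  unfold expFactorial
  rw [← Finset.mul_prod_erase _ _ (mem_univ x), ← Finset.mul_prod_erase univ _ (mem_univ x),
    ← mul_assoc]
  congr 1
  · simp [Nat.factorial_succ]
  · refine Finset.prod_congr rfl fun y hy => ?_
    simp [(Finset.ne_of_mem_erase hy).symm]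

/-- The pairing of `p` with `q`: the constant term of `p(∂) q`. -/
noncomputable def pairing (q : MvPolynomial σ ℂ) : MvPolynomial σ ℂ →ₗ[ℂ] ℂ :=
  (MvPolynomial.basisMonomials σ ℂ).constr ℂ fun D => (expFactorial D : ℂ) * q.coeff D

theorem pairing_monomial (q : MvPolynomial σ ℂ) (D : σ →₀ ℕ) :
    pairing q (MvPolynomial.monomial D 1) = (expFactorial D : ℂ) * q.coeff D := by
  unfold pairing
  have := (MvPolynomial.basisMonomials σ ℂ).constr_basis ℂ
    (fun D => (expFactorial D : ℂ) * q.coeff D) D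
  rwa [MvPolynomial.coe_basisMonomials] at this

theorem pairing_linear (a b : ℂ) (q r : MvPolynomial σ ℂ) :
    pairing (a • q + b • r) = a • pairing q + b • pairing r := by
  refine (MvPolynomial.basisMonomials σ ℂ).ext fun D => ?_
  simp only [MvPolynomial.coe_basisMonomials, LinearMap.add_apply, LinearMap.smul_apply,
    pairing_monomial, MvPolynomial.coeff_add, MvPolynomial.coeff_smul, smul_eq_mul]
  ring

theorem pairing_add (q r : MvPolynomial σ ℂ) : pairing (q + r) = pairing q + pairing r := by
  simpa using pairing_linear 1 1 q r

theorem pairing_smul (a : ℂ) (q : MvPolynomial σ ℂ) : pairing (a • q) = a • pairing q := by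
  simpa using pairing_linear a 0 q 0

theorem pairing_one (q : MvPolynomial σ ℂ) :
    pairing q 1 = MvPolynomial.constantCoeff q := by
  have := pairing_monomial q 0
  simpa [expFactorial, MvPolynomial.constantCoeff_eq] using this

/-- The operator `L` acts as the differential operator with the symbol `p`. -/
def HasSymbol (L : Module.End ℂ (MvPolynomial σ ℂ)) (p : MvPolynomial σ ℂ) : Prop :=
  ∀ q r, pairing (L q) r = pairing q (p * r)

/-- Differentiation is adjoint to multiplication by the variable: on monomials this is
$(D_x+1)!=(D_x+1)\,D_x!$. -/
theorem hasSymbol_pderiv (x : σ) :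
    HasSymbol ((MvPolynomial.pderiv (R := ℂ) x).toLinearMap) (MvPolynomial.X x) := by
  intro q
  suffices h : pairing ((MvPolynomial.pderiv x) q) =
      (pairing q).comp (LinearMap.mulLeft ℂ (MvPolynomial.X x)) from
    fun r => LinearMap.congr_fun h r
  refine (MvPolynomial.basisMonomials σ ℂ).ext fun D => ?_
  have h : (MvPolynomial.X x * MvPolynomial.monomial D 1 : MvPolynomial σ ℂ) =
      MvPolynomial.monomial (D + Finsupp.single x 1) 1 := by
    rw [MvPolynomial.X, MvPolynomial.monomial_mul, add_comm, one_mul]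
  simp only [MvPolynomial.coe_basisMonomials, LinearMap.comp_apply, LinearMap.mulLeft_apply, h,
    pairing_monomial, expFactorial_add_single, MvPolynomial.coeff_pderiv]
  push_cast
  ring

theorem HasSymbol.one : HasSymbol (1 : Module.End ℂ (MvPolynomial σ ℂ)) 1 := by
  intro q r
  simp

theorem HasSymbol.mul {L M : Module.End ℂ (MvPolynomial σ ℂ)} {p q : MvPolynomial σ ℂ}
    (hL : HasSymbol L p) (hM : HasSymbol M q) : HasSymbol (L * M) (p * q) := by
  intro r s
  rw [Module.End.mul_apply, hL, hM]
  congr 1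
  ring

theorem HasSymbol.smul {L : Module.End ℂ (MvPolynomial σ ℂ)} {p : MvPolynomial σ ℂ} (a : ℂ)
    (hL : HasSymbol L p) : HasSymbol (a • L) (a • p) := by
  intro r s
  rw [LinearMap.smul_apply, pairing_smul, LinearMap.smul_apply, hL, smul_mul_assoc, map_smul]

theorem HasSymbol.zero : HasSymbol (0 : Module.End ℂ (MvPolynomial σ ℂ)) 0 := by
  simpa using HasSymbol.smul 0 (HasSymbol.one (σ := σ))

theorem HasSymbol.add {L M : Module.End ℂ (MvPolynomial σ ℂ)} {p q : MvPolynomial σ ℂ}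
    (hL : HasSymbol L p) (hM : HasSymbol M q) : HasSymbol (L + M) (p + q) := by
  intro r s
  rw [LinearMap.add_apply, pairing_add, LinearMap.add_apply, hL, hM, add_mul, map_add]

theorem HasSymbol.sum {ι : Type*} (s : Finset ι) {L : ι → Module.End ℂ (MvPolynomial σ ℂ)}
    {p : ι → MvPolynomial σ ℂ} (h : ∀ i, HasSymbol (L i) (p i)) :
    HasSymbol (∑ i ∈ s, L i) (∑ i ∈ s, p i) := by
  classical
  induction s using Finset.induction_on with
  | empty => simpa using HasSymbol.zero
  | insert a s ha ih =>
    rw [Finset.sum_insert ha, Finset.sum_insert ha]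
    exact (h a).add ih

theorem HasSymbol.pow {L : Module.End ℂ (MvPolynomial σ ℂ)} {p : MvPolynomial σ ℂ}
    (hL : HasSymbol L p) (c : ℕ) : HasSymbol (L ^ c) (p ^ c) := by
  induction c with
  | zero => simpa using HasSymbol.one
  | succ c ih => rw [pow_succ, pow_succ]; exact ih.mul hL

theorem HasSymbol.prod_ofFn {n : ℕ} {L : Fin n → Module.End ℂ (MvPolynomial σ ℂ)}
    {p : Fin n → MvPolynomial σ ℂ} (h : ∀ i, HasSymbol (L i) (p i)) :
    HasSymbol (List.ofFn L).prod (∏ i, p i) := by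
  induction n with
  | zero => simpa using HasSymbol.one
  | succ n ih =>
    rw [List.ofFn_succ, List.prod_cons, Fin.prod_univ_succ]
    exact (h 0).mul (ih fun i => h i.succ)

theorem HasSymbol.constantCoeff {L : Module.End ℂ (MvPolynomial σ ℂ)} {p : MvPolynomial σ ℂ}
    (hL : HasSymbol L p) (q : MvPolynomial σ ℂ) :
    MvPolynomial.constantCoeff (L q) = pairing q p := by
  rw [← pairing_one, hL, mul_one]

end Pairing

/-! ### The trace as a pairing -/

section TraceFormula

variable {k n : ℕ}

/-- The symbol of `rowOp`. -/
noncomputable def rowPoly (T : Tensor k n) (i : Fin n) : AuxPoly n :=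
  ∑ β : Fin (k - 1) → Fin n, T i β • ∏ l, MvPolynomial.X (i, β l)

theorem hasSymbol_rowOp (T : Tensor k n) (i : Fin n) : HasSymbol (rowOp T i) (rowPoly T i) :=
  HasSymbol.sum _ fun _ => HasSymbol.smul _ (HasSymbol.prod_ofFn fun _ => hasSymbol_pderiv _)

/-- The polynomial `tr(A^m)` in the entries of `A`. -/
noncomputable def tracePow (n m : ℕ) : AuxPoly n :=
  Matrix.trace (Matrix.mvPolynomialX (Fin n) (Fin n) ℂ ^ m)

theorem tensorTrace_eq_pairing (d : ℕ) (T : Tensor k n) :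
    tensorTrace d T = ((k : ℂ) - 1) ^ ((n : ℤ) - 1) *
      ∑ c ∈ Finset.piAntidiag (Finset.univ : Finset (Fin n)) d,
        pairing (tracePow n (d * (k - 1)))
          (∏ i, (((c i * (k - 1)).factorial : ℂ))⁻¹ • rowPoly T i ^ c i) := by
  unfold tensorTrace
  congr 1
  refine Finset.sum_congr rfl fun c _ => ?_
  exact HasSymbol.constantCoeff
    (HasSymbol.prod_ofFn fun i => ((hasSymbol_rowOp T i).pow _).smul _) _

/-! ### Row symbols of the adjacency, degree and $\mathcal A_\alpha$ tensors. -/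

/-- The symbol of the row operator of the adjacency tensor. -/
noncomputable def edgePoly (H : Hypergraph (Fin n)) (i : Fin n) : AuxPoly n :=
  ∑ e ∈ (edges H).filter (fun e => i ∈ e), ∏ v ∈ e.erase i, MvPolynomial.X (i, v)

/-- Pigeonhole: `β` has only $k-1$ entries, so an index set of size $k$ leaves no room for a
repetition. -/
theorem image_eq_erase_of_card {e : Finset (Fin n)} {i : Fin n} (hk : 1 ≤ k) (he : e.card = k)
    (β : Fin (k - 1) → Fin n) (h : indexSet i β = e) :
    i ∈ e ∧ Function.Injective β ∧ univ.image β = e.erase i := by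
  have hi : i ∈ e := h ▸ mem_insert_self _ _
  have hle : (univ.image β).card ≤ k - 1 := by simpa using card_image_le (s := univ) (f := β)
  have hni : i ∉ univ.image β := by
    intro hmem
    have : e.card ≤ k - 1 := by
      rw [← h, indexSet, insert_eq_of_mem hmem]; exact hle
    omega
  have himg : univ.image β = e.erase i := by rw [← h, indexSet, erase_insert hni]
  refine ⟨hi, ?_, himg⟩
  rw [← Set.injOn_univ, ← coe_univ, ← card_image_iff, himg, card_erase_of_mem hi, he]
  simp

theorem card_indexSet_eq {e : Finset (Fin n)} {i : Fin n} (hk : 1 ≤ k) (he : e.card = k)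
    (hi : i ∈ e) :
    (univ.filter fun β : Fin (k - 1) → Fin n => indexSet i β = e).card = (k - 1).factorial := by
  have hc : (e.erase i).card = k - 1 := by rw [card_erase_of_mem hi, he]
  have : (univ : Finset (Fin (k - 1) ↪ (e.erase i : Finset (Fin n)))).card
      = (k - 1).factorial := by
    rw [card_univ, Fintype.card_embedding_eq, Fintype.card_coe, hc, Fintype.card_fin,
      Nat.descFactorial_self]
  rw [← this]
  symm
  refine Finset.card_bij (fun φ _ => fun l => (φ l : Fin n)) ?_ ?_ ?_
  · intro φ _
    simp only [mem_filter, mem_univ, true_and]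
    have hsub : univ.image (fun l => (φ l : Fin n)) ⊆ e.erase i := by
      intro x hx
      obtain ⟨l, -, rfl⟩ := mem_image.1 hx
      exact (φ l).2
    have : univ.image (fun l => (φ l : Fin n)) = e.erase i := by
      apply eq_of_subset_of_card_le hsub
      have hinj : Function.Injective fun l => (φ l : Fin n) :=
        Subtype.val_injective.comp φ.injective
      rw [hc, card_image_of_injective _ hinj]
      simp
    rw [indexSet, this, insert_erase hi]
  · intro φ _ ψ _ h
    ext l
    exact congrArg Fin.val (congrFun h l)
  · intro β hβ
    obtain ⟨-, hinj, himg⟩ := image_eq_erase_of_card hk he β (mem_filter.1 hβ).2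
    refine ⟨⟨fun l => ⟨β l, himg ▸ mem_image_of_mem _ (mem_univ l)⟩, ?_⟩, mem_univ _, rfl⟩
    intro a b hab
    exact hinj (congrArg Subtype.val hab)

theorem card_of_mem_edges {H : Hypergraph (Fin n)} (hH : IsUniformOn k H) {e : Finset (Fin n)}
    (he : e ∈ edges H) : e.card = k := by
  have := hH.2 e (by simpa [edges] using he)
  rwa [Set.ncard_coe_finset] at this

/-- Each hyperedge through `i` arises from $(k-1)!$ tuples `β`, which cancels the weight $1/(k-1)!$
of the tensor entries. -/
theorem rowPoly_adjTensor {H : Hypergraph (Fin n)} (hk : 1 ≤ k) (hH : IsUniformOn k H)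
    (i : Fin n) : rowPoly (adjTensor k H) i = edgePoly H i := by
  have h1 : ∀ β : Fin (k - 1) → Fin n,
      adjTensor k H i β • ∏ l, (MvPolynomial.X (i, β l) : AuxPoly n) =
      ∑ e ∈ edges H, if indexSet i β = e then
        (((k - 1).factorial : ℕ) : ℂ)⁻¹ • ∏ v ∈ e.erase i, MvPolynomial.X (i, v) else 0 := by
    intro β
    rw [Finset.sum_ite_eq, adjTensor]
    split_ifs with h
    · obtain ⟨-, hinj, himg⟩ :=
        image_eq_erase_of_card hk (card_of_mem_edges hH h) β rfl
      rw [← himg, Finset.prod_image fun a _ b _ hab => hinj hab]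
    · rw [zero_smul]
  rw [rowPoly, Finset.sum_congr rfl fun β _ => h1 β, Finset.sum_comm, edgePoly, Finset.sum_filter]
  refine Finset.sum_congr rfl fun e he => ?_
  have hek := card_of_mem_edges hH he
  rw [← Finset.sum_filter, Finset.sum_const]
  split_ifs with hi
  · rw [card_indexSet_eq hk hek hi, ← Nat.cast_smul_eq_nsmul ℂ, smul_smul, mul_inv_cancel₀,
      one_smul]
    exact_mod_cast Nat.factorial_ne_zero _
  · rw [Finset.card_eq_zero.2, zero_smul]
    refine Finset.filter_eq_empty_iff.2 fun β _ h => hi ?_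
    exact h ▸ mem_insert_self _ _

theorem rowPoly_degTensor (H : Hypergraph (Fin n)) (i : Fin n) :
    rowPoly (degTensor k H) i = (deg H i : ℂ) • MvPolynomial.X (i, i) ^ (k - 1) := by
  rw [rowPoly, Finset.sum_eq_single fun _ => i]
  · simp [degTensor]
  · intro β _ hβ
    rw [degTensor, if_neg, zero_smul]
    exact fun h => hβ (funext h)
  · simp

theorem rowPoly_alphaTensor {H : Hypergraph (Fin n)} (hk : 1 ≤ k) (hH : IsUniformOn k H)
    (α : ℝ) (i : Fin n) :
    rowPoly (alphaTensor k α H) i =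
      ((α : ℂ) * deg H i) • MvPolynomial.X (i, i) ^ (k - 1) + (1 - (α : ℂ)) • edgePoly H i := by
  rw [← rowPoly_adjTensor hk hH, mul_smul, ← rowPoly_degTensor (k := k)]
  simp only [rowPoly, alphaTensor, Pi.add_apply, Pi.smul_apply, smul_eq_mul, add_smul,
    Finset.sum_add_distrib, Finset.smul_sum, mul_smul]

end TraceFormula

/-! ### Eulerian walks and the Laplacian -/

section Euler

variable {n : ℕ}

/-- The number of arcs that leave `v`. -/
def outDeg (D : MultiDigraph n) (v : Fin n) : ℕ := ∑ w, D v w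

/-- The number of arcs that enter `v`. -/
def inDeg (D : MultiDigraph n) (v : Fin n) : ℕ := ∑ w, D w v

/-- The number of arcs. -/
def numArcs (D : MultiDigraph n) : ℕ := ∑ u, ∑ v, D u v

/-- The arc multiplicities as an exponent vector. -/
noncomputable def expo (D : MultiDigraph n) : Fin n × Fin n →₀ ℕ :=
  Finsupp.equivFunOnFinite.symm fun p => D p.1 p.2

@[simp] theorem expo_apply (D : MultiDigraph n) (p : Fin n × Fin n) : expo D p = D p.1 p.2 := rfl

/-- Removal of one arc from `u` to `v`. -/
def removeArc (D : MultiDigraph n) (u v : Fin n) : MultiDigraph n :=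
  Function.update D u (Function.update (D u) v (D u v - 1))

theorem removeArc_add (D : MultiDigraph n) {u v : Fin n} (h : 0 < D u v) (x y : Fin n) :
    removeArc D u v x y + (if x = u ∧ y = v then 1 else 0) = D x y := by
  unfold removeArc
  by_cases hx : x = u
  · subst hx
    by_cases hy : y = v
    · subst hy; simp; omega
    · simp [hy]
  · simp [hx]

theorem removeArc_of_ne (D : MultiDigraph n) {u v w : Fin n} (h : w ≠ u) :
    removeArc D u v w = D w := by
  simp [removeArc, h]

theorem outDeg_removeArc (D : MultiDigraph n) {u v : Fin n} (h : 0 < D u v) (w : Fin n) :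
    outDeg (removeArc D u v) w + (if w = u then 1 else 0) = outDeg D w := by
  unfold outDeg
  rw [← Finset.sum_congr rfl fun y _ => removeArc_add D h w y, Finset.sum_add_distrib]
  congr 1
  by_cases hw : w = u <;> simp [hw]

theorem inDeg_removeArc (D : MultiDigraph n) {u v : Fin n} (h : 0 < D u v) (w : Fin n) :
    inDeg (removeArc D u v) w + (if w = v then 1 else 0) = inDeg D w := by
  unfold inDeg
  rw [← Finset.sum_congr rfl fun y _ => removeArc_add D h y w, Finset.sum_add_distrib]
  congr 1
  by_cases hw : w = v <;> simp [hw]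

theorem numArcs_removeArc (D : MultiDigraph n) {u v : Fin n} (h : 0 < D u v) :
    numArcs (removeArc D u v) + 1 = numArcs D := by
  have : ∀ D : MultiDigraph n, numArcs D = ∑ w, outDeg D w := fun _ => rfl
  rw [this, this, ← Finset.sum_congr rfl fun w _ => outDeg_removeArc D h w,
    Finset.sum_add_distrib]
  simp

theorem expo_removeArc (D : MultiDigraph n) {u v : Fin n} (h : 0 < D u v) :
    expo (removeArc D u v) + Finsupp.single (u, v) 1 = expo D := by
  ext ⟨x, y⟩
  rw [Finsupp.add_apply, expo_apply, expo_apply, ← removeArc_add D h x y, Finsupp.single_apply]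
  simp only [Prod.mk.injEq, eq_comm]

/-- The number of walks of length `m` from `u` to `r` that use each of the (distinguished) arcs
of `D` exactly once. -/
noncomputable def walkCount (m : ℕ) (D : MultiDigraph n) (u r : Fin n) : ℂ :=
  (expFactorial (expo D) : ℂ) *
    ((Matrix.mvPolynomialX (Fin n) (Fin n) ℂ ^ m) u r).coeff (expo D)

/-- Splits off the first arc of a walk. Together with the factorials it gives the recursion
`walkCount_succ` that drives the BEST theorem. -/
theorem coeff_pow_succ (m : ℕ) (D : MultiDigraph n) (u r : Fin n) :
    ((Matrix.mvPolynomialX (Fin n) (Fin n) ℂ ^ (m + 1)) u r).coeff (expo D) =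
      ∑ v, if 0 < D u v then
        ((Matrix.mvPolynomialX (Fin n) (Fin n) ℂ ^ m) v r).coeff (expo (removeArc D u v))
      else 0 := by
  rw [pow_succ', Matrix.mul_apply, MvPolynomial.coeff_sum]
  refine Finset.sum_congr rfl fun v _ => ?_
  rw [Matrix.mvPolynomialX_apply, MvPolynomial.coeff_X_mul']
  by_cases h : 0 < D u v
  · rw [if_pos h, if_pos (by simpa using h.ne'), ← expo_removeArc D h, add_tsub_cancel_right]
  · rw [if_neg h, if_neg (by simpa using h)]

theorem walkCount_succ (m : ℕ) (D : MultiDigraph n) (u r : Fin n) :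
    walkCount (m + 1) D u r = ∑ v, (D u v : ℂ) * walkCount m (removeArc D u v) v r := by
  unfold walkCount
  rw [coeff_pow_succ, Finset.mul_sum]
  refine Finset.sum_congr rfl fun v _ => ?_
  split_ifs with h
  · rw [← expo_removeArc D h, expFactorial_add_single]
    have : expo (removeArc D u v) (u, v) + 1 = D u v := by
      have := removeArc_add D h u v
      simpa using this
    rw [this]
    push_cast
    ring
  · simp [Nat.eq_zero_of_not_pos h]

/-- The Laplacian of `D` on its vertices other than `r`, completed by the rows of the identity
matrix. -/
noncomputable def lap (D : MultiDigraph n) (r : Fin n) : Matrix (Fin n) (Fin n) ℂ :=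
  fun v => if v = r ∨ outDeg D v = 0 then Pi.single v 1
    else (outDeg D v : ℂ) • Pi.single v 1 - fun w => (D v w : ℂ)

theorem lap_row_congr {D E : MultiDigraph n} {v : Fin n} (h : D v = E v) (r : Fin n) :
    lap D r v = lap E r v := by
  have h' : outDeg D v = outDeg E v := by rw [outDeg, outDeg, h]
  simp only [lap, h', h]

/-- The indicator vector of the vertices with positive out-degree lies in the kernel: no arc enters
the other vertices, and the root is one of them. -/
theorem det_lap_eq_zero_of_inDeg_root {D : MultiDigraph n} {r : Fin n}
    (h : ∀ v, outDeg D v = 0 → inDeg D v = 0) (hr : outDeg D r = 0) (hD : numArcs D ≠ 0) :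
    (lap D r).det = 0 := by
  rw [← Matrix.exists_mulVec_eq_zero_iff]
  refine ⟨fun v => if outDeg D v = 0 then 0 else 1, ?_, ?_⟩
  · intro h0
    apply hD
    refine Finset.sum_eq_zero fun v _ => ?_
    by_contra hv
    have := congrFun h0 v
    simp only [outDeg, hv] at this
    simp at this
  · funext v
    simp only [Matrix.mulVec, lap, Pi.zero_apply]
    by_cases hv : v = r ∨ outDeg D v = 0
    · have hv' : outDeg D v = 0 := hv.elim (fun h => h ▸ hr) id
      rw [if_pos hv, single_dotProduct, if_pos hv', mul_zero]
    · rw [if_neg hv, sub_dotProduct, smul_dotProduct, single_dotProduct]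
      have hv' : outDeg D v ≠ 0 := fun h => hv (Or.inr h)
      rw [if_neg hv', sub_eq_zero, one_mul, smul_eq_mul, mul_one, outDeg, dotProduct]
      push_cast
      refine Finset.sum_congr rfl fun w _ => ?_
      split_ifs with hw
      · have := (Finset.sum_eq_zero_iff.1 (h w hw)) v (mem_univ _)
        simp [this]
      · simp

/-- The number of walks that use each arc of `D` once, by the Laplacian. -/
theorem walkCount_eq (m : ℕ) : ∀ (D : MultiDigraph n) (u r : Fin n), numArcs D = m →
    (∀ v, outDeg D v + (if v = r then 1 else 0) = inDeg D v + (if v = u then 1 else 0)) →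
    walkCount m D u r =
      (lap D r).det * ∏ v, ((if v = r then outDeg D v else outDeg D v - 1).factorial : ℂ) := by
  induction m with
  | zero =>
    intro D u r hm hD
    have h0 : ∀ x y, D x y = 0 := fun x y =>
      (Finset.sum_eq_zero_iff.1 ((Finset.sum_eq_zero_iff.1 hm) x (mem_univ _))) y (mem_univ _)
    have hout : ∀ v, outDeg D v = 0 := fun v => Finset.sum_eq_zero fun w _ => h0 v w
    have hin : ∀ v, inDeg D v = 0 := fun v => Finset.sum_eq_zero fun w _ => h0 w v
    have hur : u = r := by
      by_contra h
      have := hD u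
      simp [hout, hin, h] at this
    subst hur
    have hexp : expo D = 0 := by ext p; simp [h0]
    have hlap : lap D u = 1 := by
      ext v w
      simp [lap, hout, Matrix.one_apply, Pi.single_apply, eq_comm]
    rw [walkCount, hexp, hlap]
    simp [expFactorial, hout]
  | succ m ih =>
    intro D u r hm hD
    -- After the first arc $u\to v$, the remaining arcs satisfy the degree condition for a walk from
    -- $v$ to $r$.
    have key : ∀ v, 0 < D u v → walkCount m (removeArc D u v) v r =
        (lap (removeArc D u v) r).det *
        ∏ w, ((if w = r then outDeg (removeArc D u v) w
          else outDeg (removeArc D u v) w - 1).factorial : ℂ) := by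
      intro v hv
      refine ih _ _ _ ?_ ?_
      · have := numArcs_removeArc D hv; omega
      · intro w
        have h1 := outDeg_removeArc D hv w
        have h2 := inDeg_removeArc D hv w
        have h3 := hD w
        omega
    rw [walkCount_succ]
    by_cases hur : u = r
    · subst hur
      have hbal : ∀ v, outDeg D v = inDeg D v := fun v => by
        have := hD v; omega
      by_cases hu : outDeg D u = 0
      · rw [det_lap_eq_zero_of_inDeg_root (fun v h => hbal v ▸ h) hu (by omega), zero_mul]
        refine Finset.sum_eq_zero fun v _ => ?_
        rw [(Finset.sum_eq_zero_iff.1 hu) v (mem_univ _)]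
        simp
      -- The walk starts at the root, whose row in `lap` is an identity row. Hence removing an arc
      -- there does not change the Laplacian, and the sum over first arcs only contributes the
      -- out-degree.
      · have hlap : ∀ v, lap (removeArc D u v) u = lap D u := by
          intro v
          funext w
          by_cases hw : w = u
          · simp [lap, hw]
          · exact lap_row_congr (removeArc_of_ne D hw) u
        have hterm : ∀ v, (D u v : ℂ) * walkCount m (removeArc D u v) v u =
            (D u v : ℂ) * ((lap D u).det * (((outDeg D u - 1).factorial : ℂ) *
              ∏ w ∈ univ.erase u, ((outDeg D w - 1).factorial : ℂ))) := by
          intro v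
          by_cases hv : 0 < D u v
          · rw [key v hv, hlap, ← Finset.mul_prod_erase _ _ (mem_univ u)]
            congr 3
            · have := outDeg_removeArc D hv u
              simp only [if_true] at this ⊢
              rw [← this, Nat.add_sub_cancel]
            · refine Finset.prod_congr rfl fun w hw => ?_
              have hw' := ne_of_mem_erase hw
              rw [if_neg hw', outDeg, outDeg, removeArc_of_ne D hw']
          · simp [Nat.eq_zero_of_not_pos hv]
        rw [Finset.sum_congr rfl fun v _ => hterm v, ← Finset.sum_mul,
          ← Finset.mul_prod_erase univ _ (mem_univ u), ← Nat.cast_sum]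
        change ((outDeg D u : ℕ) : ℂ) * _ = _
        have hprod : ∏ w ∈ univ.erase u,
            ((if w = u then outDeg D w else outDeg D w - 1).factorial : ℂ) =
            ∏ w ∈ univ.erase u, ((outDeg D w - 1).factorial : ℂ) :=
          Finset.prod_congr rfl fun w hw => by rw [if_neg (ne_of_mem_erase hw)]
        rw [hprod, if_pos rfl, ← Nat.mul_factorial_pred hu]
        push_cast
        ring
    · have hu : outDeg D u = inDeg D u + 1 := by
        have := hD u
        simpa [hur] using this
      have hrow : lap D r u = (outDeg D u : ℂ) • Pi.single u 1 - fun w => (D u w : ℂ) := by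
        rw [lap, if_neg]
        omega
      have hlap' : ∀ v x, lap (removeArc D u v) r u = x →
          lap (removeArc D u v) r = (lap D r).updateRow u x := by
        intro v x hx
        funext w
        by_cases hw : w = u
        · subst hw; rw [hx, Matrix.updateRow_self]
        · rw [Matrix.updateRow_ne hw]
          exact lap_row_congr (removeArc_of_ne D hw) r
      have hfac : ∀ v, 0 < D u v →
          ∏ w, ((if w = r then outDeg (removeArc D u v) w
            else outDeg (removeArc D u v) w - 1).factorial : ℂ) =
          ((outDeg D u - 1 - 1).factorial : ℂ) * ∏ w ∈ univ.erase u,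
            ((if w = r then outDeg D w else outDeg D w - 1).factorial : ℂ) := by
        intro v hv
        rw [← Finset.mul_prod_erase _ _ (mem_univ u)]
        congr 1
        · have := outDeg_removeArc D hv u
          simp only [if_true] at this
          rw [if_neg hur, ← this, Nat.add_sub_cancel]
        · refine Finset.prod_congr rfl fun w hw => ?_
          rw [outDeg, outDeg, removeArc_of_ne D (ne_of_mem_erase hw)]
      rw [← Finset.mul_prod_erase univ _ (mem_univ u), if_neg hur]
      set F := ∏ w ∈ univ.erase u,
            ((if w = r then outDeg D w else outDeg D w - 1).factorial : ℂ) with hF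
      by_cases hu1 : outDeg D u = 1
      -- The only arc out of $u$ is used at once, and the degree condition leaves $u$ without
      -- entering arcs. After the step $u$ is isolated and its row becomes an identity row.
      · have hcol : ∀ w, D w u = 0 := fun w =>
          (Finset.sum_eq_zero_iff.1 (show inDeg D u = 0 by omega)) w (mem_univ _)
        have hdet : ∀ v, 0 < D u v → (lap (removeArc D u v) r).det = (lap D r).det := by
          intro v hv
          have hvu : v ≠ u := by
            rintro rfl
            exact hv.ne' (hcol _)
          have hDu : ∀ w, D u w = if w = v then 1 else 0 := by
            intro w
            have hsum : D u v + ∑ w ∈ univ.erase v, D u w = 1 := by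
              rw [Finset.add_sum_erase _ _ (mem_univ v)]; exact hu1
            split_ifs with hw
            · subst hw; omega
            · exact (Finset.sum_eq_zero_iff.1 (show ∑ w ∈ univ.erase v, D u w = 0 by omega)) w
                (mem_erase.2 ⟨hw, mem_univ _⟩)
          have hrow' : lap (removeArc D u v) r u = Pi.single u 1 := by
            rw [lap, if_pos]
            right
            have := outDeg_removeArc D hv u
            simp only [if_true] at this
            omega
          -- With the single arc $u\to v$ the row of $u$ is $e_u-e_v$, so $e_u$ is this row plus
          -- $e_v$. The determinant with row $e_v$ vanishes because its column $u$ is zero.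
          have hsplit : (lap D r).updateRow u (Pi.single u 1) =
              (lap D r).updateRow u (lap D r u + Pi.single v 1) := by
            congr 1
            rw [hrow, hu1]
            funext w
            simp [hDu, Pi.single_apply]
          rw [hlap' v _ hrow', hsplit, Matrix.det_updateRow_add, Matrix.updateRow_eq_self,
            add_eq_left]
          refine Matrix.det_eq_zero_of_column_eq_zero u fun w => ?_
          by_cases hw : w = u
          · subst hw
            rw [Matrix.updateRow_self, Pi.single_eq_of_ne hvu.symm]
          · rw [Matrix.updateRow_ne hw, lap]
            split_ifs
            · exact Pi.single_eq_of_ne (Ne.symm hw) _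
            · simp [hcol, Pi.single_eq_of_ne (Ne.symm hw)]
        have hterm : ∀ v, (D u v : ℂ) * walkCount m (removeArc D u v) v r =
            (D u v : ℂ) * ((lap D r).det * F) := by
          intro v
          by_cases hv : 0 < D u v
          · rw [key v hv, hfac v hv, hdet v hv, hu1]
            simp
          · simp [Nat.eq_zero_of_not_pos hv]
        rw [Finset.sum_congr rfl fun v _ => hterm v, ← Finset.sum_mul, ← Nat.cast_sum]
        change ((outDeg D u : ℕ) : ℂ) * _ = _
        rw [hu1]
        simp
      -- Removing an arc $u\to v$ changes row $u$ of the Laplacian by $-e_u+e_v$ and no other row.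
      · have hterm : ∀ v, (D u v : ℂ) * walkCount m (removeArc D u v) v r =
            ((D u v : ℂ) * ((lap D r).updateRow u (lap D r u - Pi.single u 1 + Pi.single v 1)).det) *
              (((outDeg D u - 1 - 1).factorial : ℂ) * F) := by
          intro v
          by_cases hv : 0 < D u v
          · have hout := outDeg_removeArc D hv u
            simp only [if_true] at hout
            have hrow' : lap (removeArc D u v) r u =
                lap D r u - Pi.single u 1 + Pi.single v 1 := by
              rw [hrow, lap, if_neg (by omega)]
              funext w
              have hw := removeArc_add D hv u w
              simp only [true_and] at hw
              simp only [Pi.sub_apply, Pi.add_apply, Pi.smul_apply, smul_eq_mul]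
              rw [← hw, ← hout, Pi.single_apply (i := v)]
              push_cast
              ring
            rw [key v hv, hfac v hv, hlap' v _ hrow']
            ring
          · simp [Nat.eq_zero_of_not_pos hv]
        have hlin : ∑ v, (D u v : ℂ) *
            ((lap D r).updateRow u (lap D r u - Pi.single u 1 + Pi.single v 1)).det =
            ((outDeg D u - 1 : ℕ) : ℂ) * (lap D r).det := by
          -- The weights $D(u,v)$ sum to $\deg^+u$, and $\sum_v D(u,v)e_v=\deg^+u\cdot
          -- e_u-\mathrm{row}_u$. The terms in $e_u$ cancel and $(\deg^+u-1)\,\mathrm{row}_u$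
          -- remains; its factor turns $(\deg^+u-2)!$ into $(\deg^+u-1)!$.
          have hs : ∑ v, (D u v : ℂ) • (lap D r u - Pi.single u 1 + Pi.single v 1) =
              ((outDeg D u - 1 : ℕ) : ℂ) • lap D r u := by
            simp only [smul_add, Finset.sum_add_distrib, ← Finset.sum_smul]
            have h1 : ∑ v, (D u v : ℂ) = outDeg D u := by simp [outDeg]
            have h2 : ∑ v, (D u v : ℂ) • (Pi.single v 1 : Fin n → ℂ) = fun w => (D u w : ℂ) := by
              funext w
              simp [Finset.sum_apply, Pi.single_apply]
            rw [h1, h2]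
            have h3 : (fun w => (D u w : ℂ)) = (outDeg D u : ℂ) • Pi.single u 1 - lap D r u := by
              rw [hrow]; simp
            rw [h3, Nat.cast_sub (by omega), smul_sub, Nat.cast_one, sub_smul, one_smul]
            abel
          have := (Matrix.detRowAlternating (R := ℂ) (n := Fin n)).toMultilinearMap.map_update_sum
            univ u (fun v => (D u v : ℂ) • (lap D r u - Pi.single u 1 + Pi.single v 1)) (lap D r)
          rw [hs] at this
          have h4 : ((lap D r).updateRow u (((outDeg D u - 1 : ℕ) : ℂ) • lap D r u)).det =
              ∑ v, ((lap D r).updateRow u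
                ((D u v : ℂ) • (lap D r u - Pi.single u 1 + Pi.single v 1))).det := this
          rw [Matrix.det_updateRow_smul, Matrix.updateRow_eq_self] at h4
          rw [h4]
          refine Finset.sum_congr rfl fun v _ => ?_
          rw [Matrix.det_updateRow_smul]
        rw [Finset.sum_congr rfl fun v _ => hterm v, ← Finset.sum_mul, hlin,
          ← Nat.mul_factorial_pred (show outDeg D u - 1 ≠ 0 by omega)]
        push_cast
        ring

end Euler

section ClosedWalks

variable {n : ℕ}

/-! ### Closed walks -/

theorem sum_card_steps (w : ℕ → Fin n) (m : ℕ) (x : Fin n) :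
    ∑ y, ((range m).filter fun t => w t = x ∧ w (t + 1) = y).card =
      ((range m).filter fun t => w t = x).card := by
  rw [Finset.card_eq_sum_card_fiberwise (f := fun t => w (t + 1)) (t := univ)
    (fun _ _ => mem_coe.2 (mem_univ _))]
  simp only [Finset.filter_filter]

theorem sum_card_steps' (w : ℕ → Fin n) (m : ℕ) (y : Fin n) :
    ∑ x, ((range m).filter fun t => w t = x ∧ w (t + 1) = y).card =
      ((range m).filter fun t => w (t + 1) = y).card := by
  rw [Finset.card_eq_sum_card_fiberwise (f := fun t => w t) (t := univ)
    (fun _ _ => mem_coe.2 (mem_univ _))]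
  simp only [Finset.filter_filter, and_comm]

/-- The visits to `v` at times $0,\dots,m-1$ and at times $1,\dots,m$ are equally many, since the
tour is closed. -/
theorem IsEulerTour.outDeg_eq_inDeg {D : MultiDigraph n} {w : ℕ → Fin n} (h : IsEulerTour D w)
    (v : Fin n) : outDeg D v = inDeg D v := by
  obtain ⟨h0, h1⟩ := h
  unfold outDeg inDeg
  rw [← Finset.sum_congr rfl fun y _ => h1 v y, ← Finset.sum_congr rfl fun x _ => h1 x v,
    sum_card_steps, sum_card_steps', Finset.card_filter, Finset.card_filter]
  have h2 := Finset.sum_range_succ (fun t => if w t = v then 1 else 0) (∑ u, ∑ v, D u v)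
  rw [Finset.sum_range_succ', h0] at h2
  omega

theorem exists_walk_of_coeff_ne_zero (m : ℕ) : ∀ (D : MultiDigraph n) (u r : Fin n),
    ((Matrix.mvPolynomialX (Fin n) (Fin n) ℂ ^ m) u r).coeff (expo D) ≠ 0 →
    ∃ w : ℕ → Fin n, w 0 = u ∧ w m = r ∧
      ∀ x y, ((range m).filter fun t => w t = x ∧ w (t + 1) = y).card = D x y := by
  induction m with
  | zero =>
    intro D u r h
    rw [pow_zero, Matrix.one_apply] at h
    split_ifs at h with hur
    · rw [MvPolynomial.coeff_one] at h
      have h0 : 0 = expo D := by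
        by_contra h'
        exact h (if_neg h')
      refine ⟨fun _ => u, rfl, hur, fun x y => ?_⟩
      have := DFunLike.congr_fun h0 (x, y)
      simpa using this
    · simp at h
  | succ m ih =>
    intro D u r h
    rw [coeff_pow_succ] at h
    obtain ⟨v, -, hv⟩ := Finset.exists_ne_zero_of_sum_ne_zero h
    split_ifs at hv with hD
    · obtain ⟨w, hw0, hwm, hw⟩ := ih _ _ _ hv
      refine ⟨fun t => Nat.casesOn t u w, rfl, hwm, fun x y => ?_⟩
      rw [Finset.card_filter, Finset.sum_range_succ', ← removeArc_add D hD, ← hw,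
        Finset.card_filter]
      simp only [hw0, eq_comm (a := x), eq_comm (a := y)]
      rfl
    · exact absurd rfl hv

/-- The number of closed walks of length `m` that use each of the (distinguished) arcs of `D`
exactly once. -/
noncomputable def closedWalkCount (m : ℕ) (D : MultiDigraph n) : ℂ :=
  (expFactorial (expo D) : ℂ) * (tracePow n m).coeff (expo D)

theorem closedWalkCount_eq_sum (m : ℕ) (D : MultiDigraph n) :
    closedWalkCount m D = ∑ u, walkCount m D u u := by
  simp only [closedWalkCount, tracePow, Matrix.trace, MvPolynomial.coeff_sum, Finset.mul_sum,
    walkCount, Matrix.diag_apply]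

/-- This serves twice: to make every contributing digraph balanced, and to produce Euler tours from
a nonzero BEST count. -/
theorem exists_eulerTour_of_closedWalkCount_ne_zero {m : ℕ} {D : MultiDigraph n}
    (h : closedWalkCount m D ≠ 0) : ∃ w, IsEulerTour D w := by
  rw [closedWalkCount_eq_sum] at h
  obtain ⟨u, -, hu⟩ := Finset.exists_ne_zero_of_sum_ne_zero h
  obtain ⟨w, h0, hm, hw⟩ := exists_walk_of_coeff_ne_zero m D u u (right_ne_zero_of_mul hu)
  have hcard : ∑ x, ∑ y, D x y = m := by
    rw [Finset.sum_congr rfl fun x _ => Finset.sum_congr rfl fun y _ => (hw x y).symm,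
      Finset.sum_congr rfl fun x _ => sum_card_steps w m x,
      ← Finset.card_eq_sum_card_fiberwise (f := w) (fun _ _ => mem_coe.2 (mem_univ _)),
      card_range]
  exact ⟨w, by rw [hcard, h0, hm], by rw [hcard]; exact hw⟩

/-- The two cofactors differ by a determinant whose row `u` is $e_u-e_w$. The indicator vector of
`P` is killed by that row and by all the others. -/
theorem adjugate_diag_eq (M : Matrix (Fin n) (Fin n) ℂ) (P : Finset (Fin n)) {u w : Fin n}
    (hu : u ∈ P) (hw : w ∈ P) (h : ∀ v, ∑ x ∈ P, M v x = 0) :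
    M.adjugate u u = M.adjugate w u := by
  rw [Matrix.adjugate_apply, Matrix.adjugate_apply, ← sub_eq_zero]
  have hs : (Pi.single u 1 : Fin n → ℂ) = Pi.single w 1 + (Pi.single u 1 - Pi.single w 1) := by
    abel
  rw [hs, Matrix.det_updateRow_add, add_sub_cancel_left, ← Matrix.exists_mulVec_eq_zero_iff]
  refine ⟨fun v => if v ∈ P then 1 else 0, ?_, ?_⟩
  · intro h0
    have := congrFun h0 u
    simp [hu] at this
  · funext v
    by_cases hv : v = u
    · subst hv
      rw [Matrix.mulVec, Matrix.updateRow_self, sub_dotProduct, single_dotProduct,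
        single_dotProduct, if_pos hu, if_pos hw, sub_self, Pi.zero_apply]
    · simp only [Matrix.mulVec, Matrix.updateRow_ne hv, Pi.zero_apply, dotProduct, mul_ite,
        mul_one, mul_zero]
      rw [← Finset.sum_filter, Finset.filter_mem_eq_inter, univ_inter, h]

/-- Both determinants are diagonal cofactors of the full Laplacian. In a balanced digraph its row
sums and its column sums vanish, so the cofactors are equal: one moves from $(u,u)$ to $(r,u)$ by
rows and from there to $(r,r)$ by columns. -/
theorem det_lap_eq_of_balanced {D : MultiDigraph n} (hD : ∀ v, outDeg D v = inDeg D v)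
    {u r : Fin n} (hu : outDeg D u ≠ 0) (hr : outDeg D r ≠ 0) :
    (lap D u).det = (lap D r).det := by
  let M : Matrix (Fin n) (Fin n) ℂ := fun v => if outDeg D v = 0 then Pi.single v 1
    else (outDeg D v : ℂ) • Pi.single v 1 - fun w => (D v w : ℂ)
  have hM : ∀ x, (lap D x).det = M.adjugate x x := by
    intro x
    rw [Matrix.adjugate_apply]
    congr 1
    funext v
    by_cases hv : v = x
    · subst hv; simp [lap]
    · rw [Matrix.updateRow_ne hv]
      simp only [lap, hv, false_or, M]
  let P : Finset (Fin n) := univ.filter fun v => outDeg D v ≠ 0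
  have hP : ∀ v, v ∉ P → outDeg D v = 0 := fun v hv => by simpa [P] using hv
  have hout0 : ∀ {v}, outDeg D v = 0 → ∀ w, D v w = 0 := fun h w =>
    (Finset.sum_eq_zero_iff.1 h) w (mem_univ _)
  have hin0 : ∀ {v}, outDeg D v = 0 → ∀ w, D w v = 0 := fun h w =>
    (Finset.sum_eq_zero_iff.1 (show inDeg D _ = 0 from hD _ ▸ h)) w (mem_univ _)
  have hrow : ∀ v, ∑ x ∈ P, M v x = 0 := by
    intro v
    by_cases hv : outDeg D v = 0
    · refine Finset.sum_eq_zero fun x hx => ?_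
      simp only [M, if_pos hv]
      refine Pi.single_eq_of_ne ?_ _
      rintro rfl
      exact (mem_filter.1 hx).2 hv
    · have h1 : ∑ x ∈ P, D v x = outDeg D v := by
        refine Finset.sum_subset (subset_univ _) fun x _ hx => hin0 (hP x hx) v
      have hvP : v ∈ P := by simp [P, hv]
      simp only [M, if_neg hv, Pi.sub_apply, Pi.smul_apply, Finset.sum_sub_distrib, smul_eq_mul,
        ← Finset.mul_sum, Pi.single_apply, Finset.sum_ite_eq', hvP, if_true]
      rw [← h1]
      push_cast
      ring
  have hcol : ∀ v, ∑ x ∈ P, M.transpose v x = 0 := by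
    intro v
    have h2 : ∀ x ∈ P, M.transpose v x =
        (outDeg D x : ℂ) * (if v = x then 1 else 0) - D x v := by
      intro x hx
      have hx' := (mem_filter.1 hx).2
      rw [Matrix.transpose_apply]
      simp only [M, if_neg hx']
      simp [Pi.single_apply]
    rw [Finset.sum_congr rfl h2, Finset.sum_sub_distrib]
    have h3 : ∑ x ∈ P, D x v = inDeg D v :=
      Finset.sum_subset (subset_univ _) fun x _ hx => hout0 (hP x hx) v
    rw [← Nat.cast_sum, h3, ← hD v]
    by_cases hv : outDeg D v = 0
    · rw [hv, Nat.cast_zero, sub_zero]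
      refine Finset.sum_eq_zero fun x hx => ?_
      rw [if_neg, mul_zero]
      rintro rfl
      exact (mem_filter.1 hx).2 hv
    · have hvP : v ∈ P := by simp [P, hv]
      simp [hvP]
  have huP : u ∈ P := by simp [P, hu]
  have hrP : r ∈ P := by simp [P, hr]
  rw [hM, hM, adjugate_diag_eq M P huP hrP hrow]
  have := adjugate_diag_eq M.transpose P hrP huP hcol
  rw [← Matrix.adjugate_transpose] at this
  exact this.symm

/-- The BEST theorem, with the number of spanning trees written as a determinant. -/
theorem closedWalkCount_eq {m : ℕ} {D : MultiDigraph n} (hm : numArcs D = m)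
    (hD : ∀ v, outDeg D v = inDeg D v) {r : Fin n} (hr : outDeg D r ≠ 0) :
    closedWalkCount m D = m * ((lap D r).det * ∏ v, ((outDeg D v - 1).factorial : ℂ)) := by
  have hm0 : numArcs D ≠ 0 := fun h => hr ((Finset.sum_eq_zero_iff.1 h) r (mem_univ _))
  -- Starting at $u$, the factor $(\deg^+u)!$ of the root exceeds $(\deg^+u-1)!$ by the factor
  -- $\deg^+u$. Summation over all starts then yields the number of arcs.
  have hterm : ∀ u, walkCount m D u u =
      (outDeg D u : ℂ) * ((lap D r).det * ∏ v, ((outDeg D v - 1).factorial : ℂ)) := by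
    intro u
    rw [walkCount_eq m D u u hm fun v => by rw [hD v]]
    by_cases hu : outDeg D u = 0
    · rw [det_lap_eq_zero_of_inDeg_root (fun v h => hD v ▸ h) hu hm0, hu]
      simp
    · rw [det_lap_eq_of_balanced hD hu hr, ← Finset.mul_prod_erase univ _ (mem_univ u),
        ← Finset.mul_prod_erase univ (fun v => ((outDeg D v - 1).factorial : ℂ)) (mem_univ u),
        if_pos rfl, ← Nat.mul_factorial_pred hu]
      have : ∏ w ∈ univ.erase u,
          ((if w = u then outDeg D w else outDeg D w - 1).factorial : ℂ) =
          ∏ w ∈ univ.erase u, ((outDeg D w - 1).factorial : ℂ) :=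
        Finset.prod_congr rfl fun w hw => by rw [if_neg (ne_of_mem_erase hw)]
      rw [this]
      push_cast
      ring
  rw [closedWalkCount_eq_sum, Finset.sum_congr rfl fun u _ => hterm u, ← Finset.sum_mul,
    ← hm, numArcs]
  congr 1
  simp only [outDeg]
  push_cast
  rfl

end ClosedWalks

/-! ### The matrix-tree theorem -/

section MatrixTree

variable {n : ℕ}

/-- The successor of `v` under a partial map, `v` itself if there is none. -/
def partialStep (o : Fin n → Option (Fin n)) (v : Fin n) : Fin n := (o v).getD v

/-- The matrix `1 - P` of the partial map with the matrix `P`. -/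
noncomputable def partialMatrix (o : Fin n → Option (Fin n)) : Matrix (Fin n) (Fin n) ℂ :=
  fun v => (o v).elim (Pi.single v 1) fun w => Pi.single v 1 - Pi.single w 1

/-- Ordered by the number of steps to the end of the orbit, the matrix is block triangular with
identity blocks. -/
theorem det_partialMatrix_of_terminates {o : Fin n → Option (Fin n)}
    (h : ∀ v, ∃ j, o ((partialStep o)^[j] v) = none) : (partialMatrix o).det = 1 := by
  classical
  let d : Fin n → ℕ := fun v => Nat.find (h v)
  have hd : ∀ v w, o v = some w → d w < d v := by
    intro v w hvw
    have hspec := Nat.find_spec (h v)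
    have hdv : d v = Nat.find (h v) := rfl
    rw [← hdv] at hspec
    cases hj : d v with
    | zero => rw [hj] at hspec; simp [hvw] at hspec
    | succ j =>
      rw [hj, Function.iterate_succ_apply] at hspec
      have hs : partialStep o v = w := by simp [partialStep, hvw]
      rw [hs] at hspec
      exact Nat.lt_succ_of_le (Nat.find_min' (h w) hspec)
  have htri : (partialMatrix o).BlockTriangular (fun v => OrderDual.toDual (d v)) := by
    intro v w hvw
    have hvw' : d v < d w := hvw
    have hne : w ≠ v := by rintro rfl; exact lt_irrefl _ hvw'
    unfold partialMatrix
    cases hov : o v with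
    | none => simp [Pi.single_eq_of_ne hne]
    | some x =>
      have hx : w ≠ x := by
        rintro rfl
        exact lt_asymm hvw' (hd _ _ hov)
      simp [Pi.single_eq_of_ne hne, Pi.single_eq_of_ne hx]
  rw [htri.det]
  refine Finset.prod_eq_one fun a _ => ?_
  have : (partialMatrix o).toSquareBlock (fun v => OrderDual.toDual (d v)) a = 1 := by
    ext ⟨v, hv⟩ ⟨w, hw⟩
    rw [Matrix.toSquareBlock_def, Matrix.one_apply]
    have hdd : d v = d w := OrderDual.toDual.injective (hv.trans hw.symm)
    simp only [Matrix.of_apply, Subtype.mk.injEq]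
    unfold partialMatrix
    cases hov : o v with
    | none => simp [Pi.single_apply, eq_comm]
    | some x =>
      have hx : w ≠ x := by
        rintro rfl
        have := hd _ _ hov
        omega
      simp [Pi.single_apply, hx, eq_comm]
  rw [this, Matrix.det_one]

/-- The indicator vector of the points whose orbit never ends is a nonzero kernel vector: such a
point and its successor belong to this set together. -/
theorem det_partialMatrix_of_not_terminates {o : Fin n → Option (Fin n)}
    (h : ¬ ∀ v, ∃ j, o ((partialStep o)^[j] v) = none) : (partialMatrix o).det = 0 := by
  classical
  push Not at h
  obtain ⟨v₀, hv₀⟩ := h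
  rw [← Matrix.exists_mulVec_eq_zero_iff]
  refine ⟨fun v => if ∃ j, o ((partialStep o)^[j] v) = none then 0 else 1, ?_, ?_⟩
  · intro h0
    have := congrFun h0 v₀
    simp [hv₀] at this
  · funext v
    simp only [Matrix.mulVec, partialMatrix, Pi.zero_apply]
    cases hov : o v with
    | none =>
      have : ∃ j, o ((partialStep o)^[j] v) = none := ⟨0, hov⟩
      simp [this]
    | some w =>
      have hs : partialStep o v = w := by simp [partialStep, hov]
      have : (∃ j, o ((partialStep o)^[j] v) = none) ↔ ∃ j, o ((partialStep o)^[j] w) = none := by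
        constructor
        · rintro ⟨j, hj⟩
          cases j with
          | zero => simp [hov] at hj
          | succ j => exact ⟨j, by rwa [Function.iterate_succ_apply, hs] at hj⟩
        · rintro ⟨j, hj⟩
          exact ⟨j + 1, by rwa [Function.iterate_succ_apply, hs]⟩
      rw [Option.elim_some, sub_dotProduct, single_dotProduct, single_dotProduct]
      simp only [this, sub_self]

/-- The choices of an arc that leaves `v`; there is none at the root or at an isolated vertex. -/
noncomputable def outChoices (D : MultiDigraph n) (r v : Fin n) : Finset (Option (Arc D)) :=
  if v = r ∨ outDeg D v = 0 then {none}
  else (univ.filter fun a : Arc D => a.1.1 = v).map Function.Embedding.some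

theorem lap_row_eq_sum (D : MultiDigraph n) (r v : Fin n) :
    lap D r v = ∑ o ∈ outChoices D r v,
      (o.map fun a : Arc D => a.1.2).elim (Pi.single v 1)
        fun w => Pi.single v 1 - (Pi.single w 1 : Fin n → ℂ) := by
  unfold lap outChoices
  split_ifs with h
  · simp
  · rw [Finset.sum_map, Finset.sum_filter, Fintype.sum_sigma]
    simp only [Function.Embedding.some_apply, Option.map_some, Option.elim_some,
      Finset.sum_const, Finset.card_univ, Fintype.card_fin, Fintype.sum_prod_type]
    rw [Finset.sum_eq_single v (fun u _ hu => by simp [hu]) (by simp)]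
    funext w
    simp [Finset.sum_apply, outDeg, mul_sub, Finset.sum_sub_distrib, Pi.single_apply]

-- By multilinearity the determinant is a sum over all choices of one arc out of each non-root
-- vertex. A choice contributes $1$ if following its arcs always ends, and $0$ if it contains a
-- cycle.
open Classical in
theorem det_lap_eq_card (D : MultiDigraph n) (r : Fin n) :
    (lap D r).det = (((Fintype.piFinset (outChoices D r)).filter fun φ =>
      ∀ v, ∃ j, φ ((partialStep fun v => (φ v).map fun a => a.1.2)^[j] v) = none).card : ℂ) := by
  have h1 : (lap D r).det = ∑ φ ∈ Fintype.piFinset (outChoices D r),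
      (partialMatrix fun v => (φ v).map fun a => a.1.2).det := by
    have h2 : lap D r = fun v => ∑ o ∈ outChoices D r v,
      (o.map fun a : Arc D => a.1.2).elim (Pi.single v 1)
        fun w => Pi.single v 1 - (Pi.single w 1 : Fin n → ℂ) :=
      funext (lap_row_eq_sum D r)
    rw [h2]
    exact (Matrix.detRowAlternating (R := ℂ) (n := Fin n)).toMultilinearMap.map_sum_finset
      (fun v (o : Option (Arc D)) => (o.map fun a : Arc D => a.1.2).elim (Pi.single v 1)
        fun w => Pi.single v 1 - (Pi.single w 1 : Fin n → ℂ)) (outChoices D r)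
  rw [h1, Finset.card_filter]
  push_cast
  refine Finset.sum_congr rfl fun φ _ => ?_
  split_ifs with h
  · exact det_partialMatrix_of_terminates (by simpa using h)
  · exact det_partialMatrix_of_not_terminates (by simpa using h)

theorem mem_verts_iff {D : MultiDigraph n} (hD : ∀ v, outDeg D v = inDeg D v) (v : Fin n) :
    v ∈ verts D ↔ outDeg D v ≠ 0 := by
  simp only [verts, mem_filter, mem_univ, true_and]
  constructor
  · rintro ⟨u, h | h⟩ h0
    · rw [hD v] at h0
      exact h.ne' ((Finset.sum_eq_zero_iff.1 h0) u (mem_univ _))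
    · exact h.ne' ((Finset.sum_eq_zero_iff.1 h0) u (mem_univ _))
  · intro h
    obtain ⟨u, -, hu⟩ := Finset.exists_ne_zero_of_sum_ne_zero h
    exact ⟨u, Or.inr (Nat.pos_of_ne_zero hu)⟩

/-- A spanning tree is the same as an acyclic choice of one outgoing arc at each vertex of `D` other
than the root. Balance ensures that every vertex of `D` has an outgoing arc, so the choices stop
only at the root or outside `D`. -/
theorem tau_eq_det_lap {D : MultiDigraph n} (hD : ∀ v, outDeg D v = inDeg D v) {r : Fin n} :
    (tau D r : ℂ) = (lap D r).det := by
  classical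
  have hverts := mem_verts_iff hD
  have htail : ∀ a : Arc D, a.1.1 ∈ verts D := fun a =>
    mem_filter.2 ⟨mem_univ _, a.1.2, Or.inr (Fin.pos a.2)⟩
  have hhead : ∀ a : Arc D, a.1.2 ∈ verts D := fun a =>
    mem_filter.2 ⟨mem_univ _, a.1.1, Or.inl (Fin.pos a.2)⟩
  have hchoice : ∀ φ ∈ Fintype.piFinset (outChoices D r), ∀ v,
      (φ v = none ↔ v = r ∨ v ∉ verts D) ∧ ∀ a, φ v = some a → a.1.1 = v := by
    intro φ hφ v
    have h := Fintype.mem_piFinset.1 hφ v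
    unfold outChoices at h
    rw [hverts, not_not]
    split_ifs at h with hv
    · rw [mem_singleton] at h
      simp [h, hv]
    · obtain ⟨a, ha, hav⟩ := mem_map.1 h
      rw [← hav]
      simp only [Function.Embedding.some_apply, reduceCtorEq, hv, Option.some.injEq, true_and,
        iff_self]
      rintro b rfl
      exact (mem_filter.1 ha).2
  rw [det_lap_eq_card, tau]
  congr 1
  symm
  refine Finset.card_bij (fun φ _ => univ.filter fun a : Arc D => φ a.1.1 = some a) ?_ ?_ ?_
  · intro φ hφ
    obtain ⟨hφ, hterm⟩ := mem_filter.1 hφ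
    have hc := hchoice φ hφ
    refine mem_filter.2 ⟨mem_univ _, ?_, ?_, ?_⟩
    · intro a ha har
      have := (mem_filter.1 ha).2
      rw [((hc a.1.1).1).2 (Or.inl har)] at this
      simp at this
    · intro v hv hvr
      have hne : φ v ≠ none := fun h => by
        rcases (hc v).1.1 h with h | h
        · exact hvr h
        · exact h hv
      obtain ⟨a, ha⟩ := Option.ne_none_iff_exists'.1 hne
      have hav := (hc v).2 a ha
      refine ⟨a, ⟨mem_filter.2 ⟨mem_univ _, by rw [hav, ha]⟩, hav⟩, ?_⟩
      rintro b ⟨hb, hbv⟩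
      have := (mem_filter.1 hb).2
      rw [hbv, ha] at this
      exact (Option.some.inj this).symm
    · intro v hv
      obtain ⟨j, hj⟩ := hterm v
      induction j generalizing v with
      | zero =>
        rcases (hc v).1.1 hj with h | h
        · subst h; exact Relation.ReflTransGen.refl
        · exact absurd hv h
      | succ j ih =>
        rw [Function.iterate_succ_apply] at hj
        cases hov : φ v with
        | none =>
          have hstep : partialStep (fun v => (φ v).map fun a => a.1.2) v = v := by
            simp [partialStep, hov]
          rw [hstep] at hj
          exact ih v hv hj
        | some a =>
          have hstep : partialStep (fun v => (φ v).map fun a => a.1.2) v = a.1.2 := by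
            simp [partialStep, hov]
          rw [hstep] at hj
          have hav := (hc v).2 a hov
          refine Relation.ReflTransGen.head ⟨a, mem_filter.2 ⟨mem_univ _, ?_⟩, hav, rfl⟩
            (ih a.1.2 (hhead a) hj)
          rw [hav, hov]
  · intro φ hφ ψ hψ h
    have hφ := (mem_filter.1 hφ).1
    have hψ := (mem_filter.1 hψ).1
    funext v
    cases hov : φ v with
    | none => exact ((hchoice ψ hψ v).1.2 ((hchoice φ hφ v).1.1 hov)).symm
    | some a =>
      have hav := (hchoice φ hφ v).2 a hov
      have : a ∈ univ.filter fun a : Arc D => ψ a.1.1 = some a := by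
        rw [← h]
        exact mem_filter.2 ⟨mem_univ _, by rw [hav, hov]⟩
      rw [← (mem_filter.1 this).2, hav]
  · intro T hT
    obtain ⟨h1, h2, h3⟩ := (mem_filter.1 hT).2
    choose c hc using fun v hv hvr => (h2 v hv hvr).exists
    have huniq : ∀ v (hv : v ∈ verts D) (hvr : v ≠ r) a, a ∈ T → a.1.1 = v → a = c v hv hvr :=
      fun v hv hvr a ha hav => (h2 v hv hvr).unique ⟨ha, hav⟩ (hc v hv hvr)
    let φ : Fin n → Option (Arc D) := fun v =>
      if h : v ∈ verts D ∧ v ≠ r then some (c v h.1 h.2) else none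
    have hφs : ∀ a, a ∈ T ↔ φ a.1.1 = some a := by
      intro a
      constructor
      · intro ha
        simp only [φ]
        rw [dif_pos ⟨htail a, h1 a ha⟩, ← huniq _ (htail a) (h1 a ha) a ha rfl]
      · intro ha
        simp only [φ] at ha
        split_ifs at ha with h
        rw [← Option.some.inj ha]
        exact (hc _ h.1 h.2).1
    refine ⟨φ, mem_filter.2 ⟨Fintype.mem_piFinset.2 fun v => ?_, fun v => ?_⟩, ?_⟩
    · unfold outChoices
      by_cases h : v ∈ verts D ∧ v ≠ r
      · rw [if_neg (by rw [← not_not (a := outDeg D v = 0), ← ne_eq, ← hverts]; tauto)]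
        simp only [φ, dif_pos h]
        exact mem_map_of_mem _ (mem_filter.2 ⟨mem_univ _, (hc v h.1 h.2).2⟩)
      · rw [if_pos (by rw [← not_not (a := outDeg D v = 0), ← ne_eq, ← hverts]; tauto)]
        simp only [φ, dif_neg h, mem_singleton]
    · by_cases hv : v ∈ verts D
      · refine Relation.ReflTransGen.head_induction_on (h3 v hv) ⟨0, ?_⟩ ?_
        · simp [φ]
        · rintro x y ⟨a, ha, rfl, rfl⟩ - ⟨j, hj⟩
          refine ⟨j + 1, ?_⟩
          have hstep : partialStep (fun v => (φ v).map fun a => a.1.2) a.1.1 = a.1.2 := by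
            simp [partialStep, (hφs a).1 ha]
          rw [Function.iterate_succ_apply, hstep, hj]
      · exact ⟨0, by simp [φ, hv]⟩
    · ext a
      simp [hφs a]

/-- Cayley's formula. On $S\setminus r$ the rows are $|S|\,e_v-\mathbf 1_S$, so the matrix is a
diagonal one times a rank-one perturbation of the identity, and the determinant is
$|S|^{|S|-1}\bigl(1-\frac{|S|-1}{|S|}\bigr)$. -/
theorem det_lap_complete {S : Finset (Fin n)} {r : Fin n} (hr : r ∈ S) (hS : 2 ≤ S.card) :
    (lap (fun u v => if u ∈ S ∧ v ∈ S ∧ u ≠ v then 1 else 0) r).det =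
      (S.card : ℂ) ^ (S.card - 2) := by
  have hout : ∀ v, outDeg (fun u v => if u ∈ S ∧ v ∈ S ∧ u ≠ v then 1 else 0) v =
      if v ∈ S then S.card - 1 else 0 := by
    intro v
    unfold outDeg
    split_ifs with hv
    · rw [← Finset.card_filter, ← card_erase_of_mem hv]
      congr 1
      ext w
      simp [hv, and_comm, eq_comm]
    · simp [hv]
  have hk : (S.card : ℂ) ≠ 0 := by
    have : S.card ≠ 0 := by omega
    exact_mod_cast this
  let d : Fin n → ℂ := fun v => if v ∈ S.erase r then (S.card : ℂ) else 1
  let a : Fin n → ℂ := fun v => if v ∈ S.erase r then -(S.card : ℂ)⁻¹ else 0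
  let b : Fin n → ℂ := fun v => if v ∈ S then 1 else 0
  have hM : lap (fun u v => if u ∈ S ∧ v ∈ S ∧ u ≠ v then 1 else 0) r =
      Matrix.diagonal d * (1 + Matrix.replicateCol Unit a * Matrix.replicateRow Unit b) := by
    ext v w
    rw [Matrix.diagonal_mul, Matrix.add_apply, Matrix.mul_apply]
    simp only [lap, hout, univ_unique, Matrix.replicateCol_apply, Matrix.replicateRow_apply,
      sum_singleton, Matrix.one_apply]
    by_cases hv : v ∈ S.erase r
    · obtain ⟨hvr, hvS⟩ := mem_erase.1 hv
      rw [if_neg (by simp only [hvr, hvS, if_true, false_or]; omega)]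
      simp only [d, a, b, hv, hvS, if_true, true_and, Pi.sub_apply, Pi.smul_apply, smul_eq_mul,
        Pi.single_apply, Nat.cast_sub (show 1 ≤ S.card by omega)]
      by_cases hvw : v = w
      · subst hvw
        simp only [hvS, if_true, not_true_eq_false, and_false, if_false, ne_eq]
        field_simp
        push_cast
        ring
      · simp only [Ne.symm hvw, hvw, if_false, ne_eq, not_false_eq_true, and_true]
        split_ifs
        · field_simp
          push_cast
          ring
        · simp
    · rw [if_pos]
      · simp only [d, a, if_neg hv, Pi.single_apply, eq_comm (a := w), zero_mul, add_zero, one_mul]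
      · by_cases hvr : v = r
        · exact Or.inl hvr
        · right
          rw [if_neg fun h => hv (mem_erase.2 ⟨hvr, h⟩)]
  have h1 : ∏ v, d v = (S.card : ℂ) ^ (S.card - 1) := by
    simp only [d]
    rw [Finset.prod_ite_mem, univ_inter, Finset.prod_const, card_erase_of_mem hr]
  have h2 : b ⬝ᵥ a = -((S.card : ℂ) - 1) / S.card := by
    have : ∀ v, b v * a v = if v ∈ S.erase r then -(S.card : ℂ)⁻¹ else 0 := by
      intro v
      simp only [a, b]
      split_ifs with h3 h4 h4
      · ring
      · ring
      · exact absurd (mem_of_mem_erase h4) h3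
      · ring
    rw [dotProduct, Finset.sum_congr rfl fun v _ => this v, Finset.sum_ite_mem, univ_inter,
      Finset.sum_const, card_erase_of_mem hr, nsmul_eq_mul, Nat.cast_sub (by omega)]
    field_simp
    push_cast
    ring
  rw [hM, Matrix.det_mul, Matrix.det_diagonal, Matrix.det_one_add_replicateCol_mul_replicateRow,
    h1, h2, show S.card - 1 = S.card - 2 + 1 by omega, pow_succ]
  field_simp
  ring

end MatrixTree

section Expansion

variable {k n : ℕ}

/-! ### Expansion of the trace -/

/-- Splitting each row exponent into a diagonal part and a hyperedge part amounts to choosing the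
two totals first and then distributing each of them over the rows. -/
theorem sum_piAntidiag_prod_antidiagonal {R : Type*} [CommSemiring R] (d : ℕ)
    (h : Fin n → ℕ → ℕ → R) :
    ∑ c ∈ piAntidiag (univ : Finset (Fin n)) d,
      ∏ i, ∑ p ∈ antidiagonal (c i), h i p.1 p.2 =
    ∑ q ∈ antidiagonal d, ∑ s ∈ piAntidiag (univ : Finset (Fin n)) q.1,
      ∑ t ∈ piAntidiag (univ : Finset (Fin n)) q.2, ∏ i, h i (s i) (t i) := by
  simp only [Finset.prod_univ_sum, ← Finset.sum_product']
  rw [Finset.sum_sigma', Finset.sum_sigma']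
  refine Finset.sum_bij'
    (fun x _ => ⟨(∑ i, (x.2 i).1, ∑ i, (x.2 i).2), (fun i => (x.2 i).1, fun i => (x.2 i).2)⟩)
    (fun y _ => ⟨fun i => y.2.1 i + y.2.2 i, fun i => (y.2.1 i, y.2.2 i)⟩) ?_ ?_ ?_ ?_ ?_
  · rintro ⟨c, p⟩ hx
    simp only [mem_sigma, mem_piAntidiag, Fintype.mem_piFinset, HasAntidiagonal.mem_antidiagonal, mem_product,
      mem_univ, implies_true, and_true] at hx ⊢
    rw [← Finset.sum_add_distrib, Finset.sum_congr rfl fun i _ => hx.2 i]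
    exact hx.1
  · rintro ⟨q, s, t⟩ hy
    simp only [mem_sigma, mem_piAntidiag, Fintype.mem_piFinset, HasAntidiagonal.mem_antidiagonal, mem_product,
      mem_univ, implies_true, and_true] at hy ⊢
    rw [Finset.sum_add_distrib, hy.2.1, hy.2.2, hy.1]
  · rintro ⟨c, p⟩ hx
    simp only [mem_sigma, mem_piAntidiag, Fintype.mem_piFinset, HasAntidiagonal.mem_antidiagonal] at hx
    obtain rfl : (fun i => (p i).1 + (p i).2) = c := funext hx.2
    rfl
  · rintro ⟨⟨q1, q2⟩, s, t⟩ hy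
    simp only [mem_sigma, mem_piAntidiag, HasAntidiagonal.mem_antidiagonal, mem_product] at hy
    obtain ⟨-, ⟨rfl, -⟩, ⟨rfl, -⟩⟩ := hy
    rfl
  · intro x _
    rfl

/-- The numerical factor of the part of the trace in which the row `i` contributes `s i` diagonal
factors and `t i` hyperedge factors. -/
noncomputable def rowFactor (k : ℕ) (s t : Fin n → ℕ) : ℂ :=
  ∏ i, ((s i + t i).choose (s i) : ℂ) * (((s i + t i) * (k - 1)).factorial : ℂ)⁻¹

/-- The product of the diagonal variables with the exponents `(k - 1) s i`. -/
noncomputable def loopPoly (k : ℕ) (s : Fin n → ℕ) : AuxPoly n :=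
  ∏ i, MvPolynomial.X (i, i) ^ ((k - 1) * s i)

/-- The part of the trace with `a` diagonal factors and `b` hyperedge factors. -/
noncomputable def mixedTrace (k : ℕ) (H : Hypergraph (Fin n)) (a b : ℕ) : ℂ :=
  ∑ s ∈ piAntidiag (univ : Finset (Fin n)) a, ∑ t ∈ piAntidiag (univ : Finset (Fin n)) b,
    (∏ i, (deg H i : ℂ) ^ s i) * (rowFactor k s t *
      pairing (tracePow n ((a + b) * (k - 1))) (loopPoly k s * ∏ i, edgePoly H i ^ t i))

/-- The binomial theorem in each row, with the terms sorted by the total numbers of diagonal and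
hyperedge factors. -/
theorem tensorTrace_alphaTensor {H : Hypergraph (Fin n)} (hk : 1 ≤ k) (hH : IsUniformOn k H)
    (α : ℝ) (d : ℕ) :
    tensorTrace d (alphaTensor k α H) = ((k : ℂ) - 1) ^ ((n : ℤ) - 1) *
      ∑ q ∈ antidiagonal d, (α : ℂ) ^ q.1 * (1 - (α : ℂ)) ^ q.2 * mixedTrace k H q.1 q.2 := by
  rw [tensorTrace_eq_pairing]
  congr 1
  have h1 : ∀ c : Fin n → ℕ,
      (∏ i, (((c i * (k - 1)).factorial : ℂ))⁻¹ • rowPoly (alphaTensor k α H) i ^ c i) =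
      ∏ i, ∑ p ∈ antidiagonal (c i),
        (((α : ℂ) ^ p.1 * (1 - (α : ℂ)) ^ p.2) * ((deg H i : ℂ) ^ p.1 *
          (((p.1 + p.2).choose p.1 : ℂ) * (((p.1 + p.2) * (k - 1)).factorial : ℂ)⁻¹))) •
        (MvPolynomial.X (i, i) ^ ((k - 1) * p.1) * edgePoly H i ^ p.2) := by
    intro c
    refine Finset.prod_congr rfl fun i _ => ?_
    rw [rowPoly_alphaTensor hk hH, (Commute.all _ _).add_pow', Finset.smul_sum]
    refine Finset.sum_congr rfl fun p hp => ?_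
    rw [← HasAntidiagonal.mem_antidiagonal.1 hp, smul_pow, smul_pow, smul_mul_smul_comm,
      ← Nat.cast_smul_eq_nsmul ℂ, smul_smul, smul_smul, pow_mul]
    congr 1
    ring
  rw [Finset.sum_congr rfl fun c _ => congrArg _ (h1 c), ← map_sum,
    sum_piAntidiag_prod_antidiagonal d fun i a b =>
        (((α : ℂ) ^ a * (1 - (α : ℂ)) ^ b) * ((deg H i : ℂ) ^ a *
          (((a + b).choose a : ℂ) * (((a + b) * (k - 1)).factorial : ℂ)⁻¹))) •
        (MvPolynomial.X (i, i) ^ ((k - 1) * a) * edgePoly H i ^ b), map_sum]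
  refine Finset.sum_congr rfl fun q hq => ?_
  rw [mixedTrace, Finset.mul_sum, map_sum]
  refine Finset.sum_congr rfl fun s hs => ?_
  rw [Finset.mul_sum, map_sum]
  refine Finset.sum_congr rfl fun t ht => ?_
  have hs' : ∑ i, s i = q.1 := (mem_piAntidiag.1 hs).1
  have ht' : ∑ i, t i = q.2 := (mem_piAntidiag.1 ht).1
  rw [Finset.prod_smul, map_smul, HasAntidiagonal.mem_antidiagonal.1 hq, smul_eq_mul, rowFactor,
    loopPoly]
  simp only [Finset.prod_mul_distrib, Finset.prod_pow_eq_pow_sum, hs', ht']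
  ring

theorem tensorTrace_adjTensor {H : Hypergraph (Fin n)} (hk : 1 ≤ k) (hH : IsUniformOn k H)
    (d : ℕ) :
    tensorTrace d (adjTensor k H) =
      ((k : ℂ) - 1) ^ ((n : ℤ) - 1) * mixedTrace k H 0 d := by
  rw [tensorTrace_eq_pairing, mixedTrace, piAntidiag_zero, Finset.sum_singleton]
  congr 1
  refine Finset.sum_congr rfl fun t _ => ?_
  simp only [rowPoly_adjTensor hk hH, Finset.prod_smul, map_smul, rowFactor, loopPoly,
    Pi.zero_apply, zero_add, Nat.choose_zero_right, Nat.cast_one, one_mul, mul_zero, pow_zero,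
    Finset.prod_const_one, smul_eq_mul]

/-! ### Digraphs made of stars and loops -/

/-- Addition of `(k - 1) s v` loops at each vertex `v`. -/
def addLoops (k : ℕ) (D : MultiDigraph n) (s : Fin n → ℕ) : MultiDigraph n :=
  fun u v => D u v + if u = v then (k - 1) * s u else 0

theorem outDeg_addLoops (D : MultiDigraph n) (s : Fin n → ℕ) (v : Fin n) :
    outDeg (addLoops k D s) v = outDeg D v + (k - 1) * s v := by
  simp [outDeg, addLoops, Finset.sum_add_distrib]

theorem inDeg_addLoops (D : MultiDigraph n) (s : Fin n → ℕ) (v : Fin n) :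
    inDeg (addLoops k D s) v = inDeg D v + (k - 1) * s v := by
  simp [inDeg, addLoops, Finset.sum_add_distrib]

variable {ι : Type*} [Fintype ι]

/-- The union of the stars with the centres `c j` that span the sets `g j`. -/
def stars (c : ι → Fin n) (g : ι → Finset (Fin n)) : MultiDigraph n :=
  fun u v => (univ.filter fun j => c j = u ∧ v ∈ (g j).erase u).card

theorem outDeg_stars {c : ι → Fin n} {g : ι → Finset (Fin n)} (hc : ∀ j, c j ∈ g j)
    (hg : ∀ j, (g j).card = k) (v : Fin n) :
    outDeg (stars c g) v = (k - 1) * (univ.filter fun j => c j = v).card := by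
  simp only [outDeg, stars, Finset.card_filter, Finset.mul_sum]
  rw [Finset.sum_comm]
  refine Finset.sum_congr rfl fun j _ => ?_
  by_cases h : c j = v
  · subst h
    simp only [true_and, if_true, mul_one, Finset.sum_ite_mem, univ_inter, Finset.sum_const,
      smul_eq_mul, card_erase_of_mem (hc j), hg]
  · simp [h]

theorem inDeg_stars {c : ι → Fin n} {g : ι → Finset (Fin n)} (hc : ∀ j, c j ∈ g j)
    (v : Fin n) :
    inDeg (stars c g) v + (univ.filter fun j => c j = v).card =
      (univ.filter fun j => v ∈ g j).card := by
  simp only [inDeg, stars, Finset.card_filter]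
  rw [Finset.sum_comm, ← Finset.sum_add_distrib]
  refine Finset.sum_congr rfl fun j _ => ?_
  by_cases h : c j = v
  · subst h
    simp [hc j]
  · simp [h, ite_and, Ne.symm h]

theorem stars_balanced_iff {c : ι → Fin n} {g : ι → Finset (Fin n)} (hk : 1 ≤ k)
    (hc : ∀ j, c j ∈ g j) (hg : ∀ j, (g j).card = k) (v : Fin n) :
    outDeg (stars c g) v = inDeg (stars c g) v ↔
      k * (univ.filter fun j => c j = v).card = (univ.filter fun j => v ∈ g j).card := by
  rw [outDeg_stars hc hg, ← inDeg_stars hc v]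
  obtain ⟨m, rfl⟩ := Nat.exists_eq_add_of_le' hk
  rw [Nat.add_sub_cancel, add_mul, one_mul]
  omega

theorem loopPoly_mul_prod_eq_monomial (s : Fin n → ℕ) (c : ι → Fin n)
    (g : ι → Finset (Fin n)) :
    loopPoly k s * ∏ j, ∏ v ∈ (g j).erase (c j), (MvPolynomial.X (c j, v) : AuxPoly n) =
      MvPolynomial.monomial (expo (addLoops k (stars c g) s)) 1 := by
  have h1 : loopPoly k s = MvPolynomial.monomial
      (∑ i, Finsupp.single (i, i) ((k - 1) * s i)) (1 : ℂ) := by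
    rw [MvPolynomial.monomial_sum_one, loopPoly]
    exact Finset.prod_congr rfl fun i _ => MvPolynomial.X_pow_eq_monomial
  have h2 : ∏ j, ∏ v ∈ (g j).erase (c j), (MvPolynomial.X (c j, v) : AuxPoly n) =
      MvPolynomial.monomial
        (∑ j, ∑ v ∈ (g j).erase (c j), Finsupp.single (c j, v) 1) (1 : ℂ) := by
    rw [MvPolynomial.monomial_sum_one]
    refine Finset.prod_congr rfl fun j _ => ?_
    rw [MvPolynomial.monomial_sum_one]
    rfl
  rw [h1, h2, MvPolynomial.monomial_mul, one_mul]
  congr 2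
  ext ⟨u, v⟩
  simp only [Finsupp.add_apply, Finsupp.finsetSum_apply, expo_apply, addLoops, stars,
    Finset.card_filter, Finsupp.single_apply, Prod.mk.injEq]
  rw [add_comm]
  congr 1
  · refine Finset.sum_congr rfl fun j _ => ?_
    by_cases h : c j = u
    · subst h
      simp
    · simp [h]
  · by_cases h : u = v
    · subst h; simp
    · rw [if_neg h]
      refine Finset.sum_eq_zero fun i _ => if_neg ?_
      rintro ⟨rfl, rfl⟩
      exact h rfl

theorem pairing_prod_edgePoly [DecidableEq ι] (H : Hypergraph (Fin n)) (m : ℕ) (s : Fin n → ℕ)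
    (c : ι → Fin n) :
    pairing (tracePow n m) (loopPoly k s * ∏ j, edgePoly H (c j)) =
      ∑ g ∈ Fintype.piFinset fun j => (edges H).filter fun e => c j ∈ e,
        closedWalkCount m (addLoops k (stars c g) s) := by
  simp only [edgePoly]
  rw [Finset.prod_univ_sum, Finset.mul_sum, map_sum]
  refine Finset.sum_congr rfl fun g _ => ?_
  rw [loopPoly_mul_prod_eq_monomial, pairing_monomial, closedWalkCount]

/-- The decisive constraint. A closed walk makes in- and out-degrees equal, and the loops contribute
equally to both. A star centred at `v` adds $k-1$ to the out-degree of `v`, and a star that only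
passes through `v` adds $1$ to its in-degree. -/
theorem mul_card_eq_of_closedWalkCount_ne_zero {m : ℕ} {s : Fin n → ℕ} {c : ι → Fin n}
    {g : ι → Finset (Fin n)} (hk : 1 ≤ k) (hc : ∀ j, c j ∈ g j) (hg : ∀ j, (g j).card = k)
    (h : closedWalkCount m (addLoops k (stars c g) s) ≠ 0) (v : Fin n) :
    k * (univ.filter fun j => c j = v).card = (univ.filter fun j => v ∈ g j).card := by
  obtain ⟨w, hw⟩ := exists_eulerTour_of_closedWalkCount_ne_zero h
  have := hw.outDeg_eq_inDeg v
  rw [outDeg_addLoops, inDeg_addLoops] at this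
  rw [← stars_balanced_iff hk hc hg]
  omega

/-- A vertex that is the centre of $t_v$ stars would have to lie in $k\,t_v$ of the chosen
hyperedges, more than there are. -/
theorem pairing_eq_zero_of_lt {H : Hypergraph (Fin n)} (hk : 1 ≤ k) (hH : IsUniformOn k H)
    (m : ℕ) (s t : Fin n → ℕ) {v : Fin n} (hv : ∑ i, t i < k * t v) :
    pairing (tracePow n m) (loopPoly k s * ∏ i, edgePoly H i ^ t i) = 0 := by
  have h1 : ∏ i, edgePoly H i ^ t i = ∏ j : (Σ i, Fin (t i)), edgePoly H j.1 := by
    rw [Fintype.prod_sigma]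
    simp
  rw [h1, pairing_prod_edgePoly]
  refine Finset.sum_eq_zero fun g hg => ?_
  by_contra h
  have hg' := fun j => mem_filter.1 (Fintype.mem_piFinset.1 hg j)
  have h2 := mul_card_eq_of_closedWalkCount_ne_zero hk (fun j => (hg' j).2)
    (fun j => card_of_mem_edges hH (hg' j).1) h v
  have h3 : (univ.filter fun j : (Σ i, Fin (t i)) => j.1 = v).card = t v := by
    rw [Finset.card_filter, Fintype.sum_sigma, Finset.sum_eq_single v] <;> simp +contextual
  have h4 : (univ.filter fun j => v ∈ g j).card ≤ ∑ i, t i := by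
    refine (card_le_univ _).trans ?_
    simp [Fintype.card_sigma]
  rw [h3] at h2
  omega

theorem mixedTrace_eq_zero {H : Hypergraph (Fin n)} (hH : IsUniformOn k H) (a : ℕ) {b : ℕ}
    (hb : 0 < b) (hbk : b < k) : mixedTrace k H a b = 0 := by
  refine Finset.sum_eq_zero fun s _ => Finset.sum_eq_zero fun t ht => ?_
  have hsum : ∑ i, t i = b := (mem_piAntidiag.1 ht).1
  obtain ⟨v, -, hv⟩ := Finset.exists_ne_zero_of_sum_ne_zero (hsum.trans_ne hb.ne')
  rw [pairing_eq_zero_of_lt (by omega) hH _ _ _ (v := v), mul_zero, mul_zero]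
  have : k * 1 ≤ k * t v := Nat.mul_le_mul_left _ (Nat.pos_of_ne_zero hv)
  omega

/-- If there are fewer than `2k` hyperedge factors, then only those parts contribute in which
each row has at most one of them. -/
theorem mixedTrace_eq_sum_powersetCard {H : Hypergraph (Fin n)} (hk : 1 ≤ k)
    (hH : IsUniformOn k H) (a : ℕ) {b : ℕ} (hb : b < 2 * k) :
    mixedTrace k H a b = ∑ S ∈ powersetCard b (univ : Finset (Fin n)),
      ∑ s ∈ piAntidiag (univ : Finset (Fin n)) a, (∏ i, (deg H i : ℂ) ^ s i) *
        ∑ g ∈ Fintype.piFinset fun j : S => (edges H).filter fun e => (j : Fin n) ∈ e,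
          rowFactor k s (fun v => if v ∈ S then 1 else 0) *
            closedWalkCount ((a + b) * (k - 1))
              (addLoops k (stars (Subtype.val : S → Fin n) g) s) := by
  rw [Finset.sum_comm, mixedTrace]
  refine Finset.sum_congr rfl fun s _ => ?_
  rw [← Finset.mul_sum, ← Finset.mul_sum]
  congr 1
  have hsub : (powersetCard b (univ : Finset (Fin n))).image
      (fun S v => if v ∈ S then 1 else 0) ⊆ piAntidiag (univ : Finset (Fin n)) b := by
    intro t ht
    obtain ⟨S, hS, rfl⟩ := mem_image.1 ht
    simp [(mem_powersetCard.1 hS).2]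
  rw [← Finset.sum_subset hsub, Finset.sum_image]
  · refine Finset.sum_congr rfl fun S _ => ?_
    rw [← Finset.mul_sum, ← pairing_prod_edgePoly]
    congr 3
    rw [Finset.prod_coe_sort S (fun i => edgePoly H i)]
    simp only [pow_ite, pow_one, pow_zero, Finset.prod_ite_mem, univ_inter]
  · intro S _ T _ h
    ext v
    have := congrFun h v
    by_cases h1 : v ∈ S <;> by_cases h2 : v ∈ T <;> simp_all
  -- A row with two hyperedge factors would require at least $2k$ of them in all; otherwise `t` is
  -- the indicator of its support.
  · intro t ht hnot
    have hsum : ∑ i, t i = b := (mem_piAntidiag.1 ht).1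
    by_cases h : ∃ v, 2 ≤ t v
    · obtain ⟨v, hv⟩ := h
      rw [pairing_eq_zero_of_lt hk hH _ _ _ (v := v), mul_zero]
      have : k * 2 ≤ k * t v := Nat.mul_le_mul_left _ hv
      omega
    · push Not at h
      refine absurd (mem_image.2 ⟨univ.filter fun v => t v ≠ 0, ?_, ?_⟩) hnot
      · rw [mem_powersetCard]
        refine ⟨subset_univ _, ?_⟩
        rw [← hsum, Finset.card_filter]
        refine Finset.sum_congr rfl fun v _ => ?_
        have := h v
        split_ifs <;> omega
      · funext v
        have := h v
        simp only [mem_filter, mem_univ, true_and]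
        split_ifs <;> omega

/-! ### Closed walks in the presence of loops. -/

/-- The number of closed walks of a digraph with added loops. -/
theorem rowFactor_mul_closedWalkCount (hk : 2 ≤ k) {S : Finset (Fin n)} {D : MultiDigraph n}
    (hD : ∀ v, outDeg D v = inDeg D v) (hout : ∀ v, outDeg D v = if v ∈ S then k - 1 else 0)
    {s : Fin n → ℕ} {a : ℕ} (hs : ∑ v, s v = a) {r : Fin n} (hr : r ∈ S) :
    rowFactor k s (fun v => if v ∈ S then 1 else 0) *
      closedWalkCount ((a + S.card) * (k - 1)) (addLoops k D s) =
    if ∀ v, s v ≠ 0 → v ∈ S then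
      (((a + S.card) * (k - 1) : ℕ) : ℂ) * (((k - 1 : ℕ) : ℂ)⁻¹ ^ S.card * (lap D r).det)
    else 0 := by
  have hout' : ∀ v, outDeg (addLoops k D s) v = (s v + if v ∈ S then 1 else 0) * (k - 1) := by
    intro v
    rw [outDeg_addLoops, hout]
    split_ifs <;> ring
  have hr0 : outDeg (addLoops k D s) r ≠ 0 := by
    rw [hout', if_pos hr]
    exact Nat.mul_ne_zero (by omega) (by omega)
  have hm : numArcs (addLoops k D s) = (a + S.card) * (k - 1) := by
    change ∑ v, outDeg (addLoops k D s) v = _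
    rw [Finset.sum_congr rfl fun v _ => hout' v, ← Finset.sum_mul, Finset.sum_add_distrib, hs]
    simp
  rw [closedWalkCount_eq hm (fun v => by rw [outDeg_addLoops, inDeg_addLoops, hD]) hr0]
  split_ifs with hsupp
  -- A loop cancels in $\deg^+v\cdot e_v-D(v,\cdot)$. The hypothesis on the support of `s` ensures
  -- that no isolated vertex acquires a non-identity row.
  · have hlap : lap (addLoops k D s) r = lap D r := by
      funext v
      have hiff : outDeg (addLoops k D s) v = 0 ↔ outDeg D v = 0 := by
        rw [outDeg_addLoops]
        have := hout v
        have h2 := hsupp v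
        constructor
        · omega
        · intro h
          rw [h] at this ⊢
          split_ifs at this with hv
          · omega
          · have : s v = 0 := by
              by_contra h'
              exact hv (h2 h')
            rw [this, mul_zero, add_zero]
      simp only [lap, hiff]
      split_ifs
      · rfl
      · funext w
        rw [outDeg_addLoops]
        by_cases hvw : v = w
        · subst hvw
          simp [addLoops]
        · simp [addLoops, hvw, Ne.symm hvw]
    -- For $v\in S$ the factor is
    -- $(s_v+1)\,\dfrac{((s_v+1)(k-1)-1)!}{((s_v+1)(k-1))!}=\dfrac1{k-1}$, whatever $s_v$ is.
    have hfac : rowFactor k s (fun v => if v ∈ S then 1 else 0) *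
        ∏ v, ((outDeg (addLoops k D s) v - 1).factorial : ℂ) =
        ((k - 1 : ℕ) : ℂ)⁻¹ ^ S.card := by
      rw [rowFactor, ← Finset.prod_mul_distrib]
      have hterm : ∀ v, (((s v + if v ∈ S then 1 else 0).choose (s v) : ℂ) *
          (((s v + if v ∈ S then 1 else 0) * (k - 1)).factorial : ℂ)⁻¹) *
          ((outDeg (addLoops k D s) v - 1).factorial : ℂ) =
          if v ∈ S then ((k - 1 : ℕ) : ℂ)⁻¹ else 1 := by
        intro v
        rw [hout']
        split_ifs with hv
        · have h0 : (s v + 1) * (k - 1) ≠ 0 := Nat.mul_ne_zero (by omega) (by omega)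
          have hk0 : ((k - 1 : ℕ) : ℂ) ≠ 0 := by
            have : k - 1 ≠ 0 := by omega
            exact_mod_cast this
          have hs0 : ((s v : ℂ) + 1) ≠ 0 := by exact_mod_cast Nat.succ_ne_zero (s v)
          have hf : ((((s v + 1) * (k - 1) - 1).factorial : ℕ) : ℂ) ≠ 0 := by
            exact_mod_cast Nat.factorial_ne_zero _
          rw [← Nat.mul_factorial_pred h0, Nat.choose_succ_self_right]
          push_cast
          field_simp
        · have : s v = 0 := by
            by_contra h'
            exact hv (hsupp v h')
          simp [this]
      rw [Finset.prod_congr rfl fun v _ => hterm v, Finset.prod_ite_mem, univ_inter,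
        Finset.prod_const]
    rw [hlap, ← hfac]
    ring
  · push Not at hsupp
    obtain ⟨v, hv0, hvS⟩ := hsupp
    have hD0 : ∀ w, D v w = 0 := fun w =>
      (Finset.sum_eq_zero_iff.1 (show outDeg D v = 0 by rw [hout, if_neg hvS])) w (mem_univ _)
    -- A vertex that carries only loops and is not the root has a zero row: it cannot be reached.
    have hdet : (lap (addLoops k D s) r).det = 0 := by
      refine Matrix.det_eq_zero_of_row_eq_zero v fun w => ?_
      rw [lap, if_neg]
      · rw [outDeg_addLoops, hout, if_neg hvS]
        by_cases hvw : v = w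
        · subst hvw
          simp [addLoops, hD0]
        · simp [addLoops, hD0, hvw, Ne.symm hvw]
      · rintro (rfl | h)
        · exact hvS hr
        · rw [hout', if_neg hvS] at h
          exact Nat.mul_ne_zero hv0 (by omega) h
    rw [hdet]
    ring

/-- The part of the trace that has only diagonal factors. -/
theorem mixedTrace_zero_right (hk : 2 ≤ k) (H : Hypergraph (Fin n)) {d : ℕ} (hd : d ≠ 0) :
    mixedTrace k H d 0 = ∑ i, (deg H i : ℂ) ^ d := by
  have hsub : (univ : Finset (Fin n)).image (fun i => Pi.single i d) ⊆
      piAntidiag (univ : Finset (Fin n)) d := by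
    intro s hs
    obtain ⟨i, -, rfl⟩ := mem_image.1 hs
    simp
  have hbal : ∀ (s : Fin n → ℕ) v, outDeg (addLoops k (fun _ _ => 0) s) v =
      inDeg (addLoops k (fun _ _ => 0) s) v := fun s v => by
    rw [outDeg_addLoops, inDeg_addLoops]
    rfl
  have hout : ∀ (s : Fin n → ℕ) v, outDeg (addLoops k (fun _ _ => 0) s) v = (k - 1) * s v :=
    fun s v => by
      rw [outDeg_addLoops]
      simp [outDeg]
  have hm : ∀ s ∈ piAntidiag (univ : Finset (Fin n)) d,
      numArcs (addLoops k (fun _ _ => 0) s) = (d + 0) * (k - 1) := by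
    intro s hs
    change ∑ v, outDeg _ v = _
    rw [Finset.sum_congr rfl fun v _ => hout s v, ← Finset.mul_sum, (mem_piAntidiag.1 hs).1,
      mul_comm, add_zero]
  have hpair : ∀ s : Fin n → ℕ, pairing (tracePow n ((d + 0) * (k - 1)))
      (loopPoly k s * ∏ i, edgePoly H i ^ (0 : Fin n → ℕ) i) =
      closedWalkCount ((d + 0) * (k - 1)) (addLoops k (fun _ _ => 0) s) := by
    intro s
    have h1 := loopPoly_mul_prod_eq_monomial (k := k) (ι := Fin 0) s Fin.elim0 Fin.elim0
    have h2 : stars (Fin.elim0 : Fin 0 → Fin n) Fin.elim0 = fun _ _ => 0 := by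
      funext u v
      simp [stars]
    rw [h2] at h1
    simp only [univ_eq_empty, Finset.prod_empty] at h1
    simp only [Pi.zero_apply, pow_zero, Finset.prod_const_one]
    rw [h1, pairing_monomial, closedWalkCount]
  rw [mixedTrace, piAntidiag_zero]
  simp only [Finset.sum_singleton, hpair]
  rw [← Finset.sum_subset hsub, Finset.sum_image]
  · refine Finset.sum_congr rfl fun i _ => ?_
    have h1 : ∏ v, (deg H v : ℂ) ^ (Pi.single i d : Fin n → ℕ) v = (deg H i : ℂ) ^ d := by
      rw [Finset.prod_eq_single i]
      · simp
      · intro v _ hv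
        simp [Pi.single_eq_of_ne hv]
      · simp
    have h0 : (k - 1) * d ≠ 0 := Nat.mul_ne_zero (by omega) hd
    have hlap : lap (addLoops k (fun _ _ => 0) (Pi.single i d)) i = 1 := by
      funext v
      rw [lap, if_pos]
      · funext w
        rw [Matrix.one_apply, Pi.single_apply]
        simp [eq_comm]
      · by_cases hv : v = i
        · exact Or.inl hv
        · right
          rw [hout, Pi.single_eq_of_ne hv, mul_zero]
    have h2 : ∏ v, ((outDeg (addLoops k (fun _ _ => 0) (Pi.single i d)) v - 1).factorial : ℂ) =
        (((k - 1) * d - 1).factorial : ℂ) := by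
      simp only [hout]
      rw [Finset.prod_eq_single i]
      · simp
      · intro v _ hv
        simp [Pi.single_eq_of_ne hv]
      · simp
    have h3 : rowFactor k (Pi.single i d : Fin n → ℕ) 0 = (((k - 1) * d).factorial : ℂ)⁻¹ := by
      rw [rowFactor, Finset.prod_eq_single i]
      · simp [mul_comm]
      · intro v _ hv
        simp [Pi.single_eq_of_ne hv]
      · simp
    -- With $m=(k-1)d$ loops at one vertex the weight is $m\cdot(m-1)!/m!=1$.
    rw [h1, h3, closedWalkCount_eq (hm _ (hsub (mem_image_of_mem _ (mem_univ i)))) (hbal _)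
      (r := i) (by rw [hout]; simpa using h0), hlap, Matrix.det_one, h2, one_mul, add_zero,
      mul_comm d, ← Nat.cast_mul, Nat.mul_factorial_pred h0, inv_mul_cancel₀, mul_one]
    exact_mod_cast Nat.factorial_ne_zero _
  · intro i _ j _ h
    by_contra hij
    have := congrFun h i
    simp only [Pi.single_eq_same, Pi.single_eq_of_ne hij] at this
    exact hd this
  · intro s hs hnot
    have hsum := (mem_piAntidiag.1 hs).1
    obtain ⟨r, -, hr⟩ := Finset.exists_ne_zero_of_sum_ne_zero (hsum.trans_ne hd)
    obtain ⟨v, hvr, hv⟩ : ∃ v, v ≠ r ∧ s v ≠ 0 := by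
      by_contra! h
      refine hnot (mem_image.2 ⟨r, mem_univ _, ?_⟩)
      have hd' : s r = d := by
        rw [← hsum, Finset.sum_eq_single r (fun v _ hv => h v hv) (by simp)]
      funext v
      by_cases hv : v = r
      · subst hv
        simp [hd']
      · rw [Pi.single_eq_of_ne hv, h v hv]
    -- Loops at two different vertices are disconnected: rooting at one of them leaves a zero row at
    -- the other.
    have hdet : (lap (addLoops k (fun _ _ => 0) s) r).det = 0 := by
      refine Matrix.det_eq_zero_of_row_eq_zero v fun w => ?_
      rw [lap, if_neg]
      · rw [hout]
        by_cases hvw : v = w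
        · subst hvw
          simp [addLoops]
        · simp [addLoops, hvw, Ne.symm hvw]
      · rintro (h | h)
        · exact hvr h
        · rw [hout] at h
          exact Nat.mul_ne_zero (by omega) hv h
    rw [closedWalkCount_eq (hm s hs) (hbal s) (r := r)
      (by rw [hout]; exact Nat.mul_ne_zero (by omega) hr), hdet]
    ring

end Expansion

section StarFamilies

variable {k n : ℕ}

/-! ### Families of stars in a complete hypergraph -/

open Classical in
/-- The choices of one `k`-subset `g i ∋ i` of `S` for each `i ∈ S` for which each vertex of `S`
is covered `k` times. -/
noncomputable def starFamilies (k : ℕ) (S : Finset (Fin n)) : Finset (S → Finset (Fin n)) :=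
  univ.filter fun g => (∀ i, (i : Fin n) ∈ g i ∧ g i ∈ powersetCard k S) ∧
    ∀ v ∈ S, (univ.filter fun i => v ∈ g i).card = k

theorem mem_starFamilies {S : Finset (Fin n)} {g : S → Finset (Fin n)} :
    g ∈ starFamilies k S ↔ (∀ i, (i : Fin n) ∈ g i ∧ g i ∈ powersetCard k S) ∧
      ∀ v ∈ S, (univ.filter fun i => v ∈ g i).card = k := by
  simp [starFamilies]

theorem card_filter_coe_eq (S : Finset (Fin n)) (v : Fin n) :
    (univ.filter fun j : S => (j : Fin n) = v).card = if v ∈ S then 1 else 0 := by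
  rw [Finset.card_filter, Finset.sum_coe_sort S (fun j => if j = v then 1 else 0)]
  simp

theorem stars_self {ι : Type*} [Fintype ι] (c : ι → Fin n) (g : ι → Finset (Fin n)) (u : Fin n) :
    stars c g u u = 0 := by
  simp [stars]

theorem stars_coe_apply {S : Finset (Fin n)} (g : S → Finset (Fin n)) (i : S) (v : Fin n) :
    stars Subtype.val g i v = if v ∈ (g i).erase i then 1 else 0 := by
  simp only [stars, Finset.card_filter]
  rw [Finset.sum_eq_single i]
  · simp
  · intro j _ hj
    rw [if_neg]
    rintro ⟨h, -⟩
    exact hj (Subtype.ext h)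
  · simp

/-- Each vertex of `S` is the centre of exactly one star, so the arcs that leave `i` recover `g i`.
-/
theorem stars_coe_injOn (S : Finset (Fin n)) :
    Set.InjOn (fun g : S → Finset (Fin n) => stars Subtype.val g) (starFamilies k S) := by
  intro g hg h hh hgh
  funext i
  have h1 : (g i).erase i = (h i).erase i := by
    ext v
    have := congrFun (congrFun hgh i) v
    simp only [stars_coe_apply] at this
    by_cases ha : v ∈ (g i).erase i <;> by_cases hb : v ∈ (h i).erase i <;> simp_all
  rw [← insert_erase ((mem_starFamilies.1 hg).1 i).1, h1,
    insert_erase ((mem_starFamilies.1 hh).1 i).1]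

theorem outDeg_stars_coe {S : Finset (Fin n)} {g : S → Finset (Fin n)}
    (hc : ∀ i, (i : Fin n) ∈ g i) (hg : ∀ i, (g i).card = k) (v : Fin n) :
    outDeg (stars Subtype.val g) v = if v ∈ S then k - 1 else 0 := by
  rw [outDeg_stars hc hg, card_filter_coe_eq]
  simp

theorem balanced_of_mem_starFamilies {S : Finset (Fin n)} (hk : 1 ≤ k) {g : S → Finset (Fin n)}
    (hg : g ∈ starFamilies k S) (v : Fin n) :
    outDeg (stars Subtype.val g) v = inDeg (stars Subtype.val g) v := by
  obtain ⟨h1, h2⟩ := mem_starFamilies.1 hg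
  rw [stars_balanced_iff hk (fun i => (h1 i).1) fun i => (mem_powersetCard.1 (h1 i).2).2,
    card_filter_coe_eq]
  split_ifs with hv
  · rw [h2 v hv, mul_one]
  · rw [mul_zero, eq_comm, Finset.card_eq_zero, Finset.filter_eq_empty_iff]
    exact fun i _ hi => hv ((mem_powersetCard.1 (h1 i).2).1 hi)

/-- If two stars spanned the same set, a vertex of `S` missing from it would be covered by at most
$k-1$ sets. -/
theorem injective_of_mem_starFamilies {S : Finset (Fin n)} (hS : S.card = k + 1)
    {g : S → Finset (Fin n)} (hg : g ∈ starFamilies k S) : Function.Injective g := by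
  obtain ⟨h1, h2⟩ := mem_starFamilies.1 hg
  intro i j hij
  by_contra hne
  obtain ⟨hsub, hcard⟩ := mem_powersetCard.1 (h1 i).2
  obtain ⟨x, hxS, hx⟩ : ∃ x ∈ S, x ∉ g i := by
    by_contra! h
    have := card_le_card (show S ⊆ g i from h)
    omega
  have hle : (univ.filter fun l => x ∈ g l) ⊆ univ \ {i, j} := by
    intro l hl
    rw [mem_sdiff, mem_insert, mem_singleton]
    refine ⟨mem_univ _, ?_⟩
    have := (mem_filter.1 hl).2
    rintro (rfl | rfl)
    · exact hx this
    · exact hx (hij ▸ this)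
  have h3 := card_le_card hle
  rw [h2 x hxS, card_sdiff_of_subset (subset_univ _), card_pair hne, card_univ, Fintype.card_coe,
    hS] at h3
  have : 2 ≤ S.card := by
    rw [← Fintype.card_coe, ← card_univ, ← card_pair hne]
    exact card_le_card (subset_univ _)
  omega

theorem image_of_mem_starFamilies {S : Finset (Fin n)} (hS : S.card = k + 1)
    {g : S → Finset (Fin n)} (hg : g ∈ starFamilies k S) : univ.image g = powersetCard k S := by
  refine eq_of_subset_of_card_le ?_ ?_
  · intro e he
    obtain ⟨i, -, rfl⟩ := mem_image.1 he
    exact ((mem_starFamilies.1 hg).1 i).2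
  · rw [card_image_of_injective _ (injective_of_mem_starFamilies hS hg), card_powersetCard,
      card_univ, Fintype.card_coe, hS, Nat.choose_succ_self_right]

/-! ### The digraphs of index sequences -/

theorem digraphOf_eq_sum {d : ℕ} (f : IndexSeq k n d) (u v : Fin n) :
    digraphOf f u v =
      ∑ j, if (f j).1 = u then (univ.filter fun l => (f j).2 l = v).card else 0 := by
  simp only [digraphOf, Finset.card_filter, Fintype.sum_prod_type]
  refine Finset.sum_congr rfl fun j _ => ?_
  split_ifs with h <;> simp [h]

theorem card_filter_eq_of_card_indexSet (hk : 1 ≤ k) {i : Fin n} {β : Fin (k - 1) → Fin n}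
    (h : (indexSet i β).card = k) (v : Fin n) :
    (univ.filter fun l => β l = v).card = if v ∈ (indexSet i β).erase i then 1 else 0 := by
  obtain ⟨-, hinj, himg⟩ := image_eq_erase_of_card hk h β rfl
  rw [← himg]
  split_ifs with hv
  · obtain ⟨l, -, rfl⟩ := mem_image.1 hv
    rw [Finset.card_eq_one]
    refine ⟨l, ?_⟩
    ext l'
    simp [hinj.eq_iff]
  · rw [Finset.card_eq_zero, Finset.filter_eq_empty_iff]
    exact fun l _ hl => hv (mem_image.2 ⟨l, mem_univ _, hl⟩)

theorem deleteLoops_addLoops_stars {ι : Type*} [Fintype ι] (c : ι → Fin n)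
    (g : ι → Finset (Fin n)) (s : Fin n → ℕ) :
    deleteLoops (addLoops k (stars c g) s) = stars c g := by
  funext u v
  unfold deleteLoops addLoops
  split_ifs with h
  · rw [h, stars_self]
  · rw [add_zero]

/-- The stars and one diagonal entry make up a sequence of length $k+2$. The spanning tree
guarantees, by the BEST theorem, that its digraph has an Euler tour. -/
theorem stars_mem_loopFreeDigraphs (hk : 2 ≤ k) {S : Finset (Fin n)} (hS : S.card = k + 1)
    {g : S → Finset (Fin n)} (hg : g ∈ starFamilies k S) {r : Fin n} (hr : r ∈ S)
    (hτ : tau (stars Subtype.val g) r ≠ 0) :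
    stars Subtype.val g ∈ loopFreeDigraphs k S := by
  classical
  obtain ⟨h1, h2⟩ := mem_starFamilies.1 hg
  have hcard : ∀ i, (g i).card = k := fun i => (mem_powersetCard.1 (h1 i).2).2
  have hbal := balanced_of_mem_starFamilies (by omega) hg
  have hout := outDeg_stars_coe (fun i => (h1 i).1) hcard
  -- The loops of the one additional entry $r\cdots r$, placed at the given vertex of `S`.
  let s : Fin n → ℕ := Pi.single r 1
  obtain ⟨w, hw⟩ : ∃ w, IsEulerTour (addLoops k (stars Subtype.val g) s) w := by
    apply exists_eulerTour_of_closedWalkCount_ne_zero (m := (1 + S.card) * (k - 1))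
    have hsupp : ∀ v, s v ≠ 0 → v ∈ S := by
      intro v hv
      by_cases hvr : v = r
      · exact hvr ▸ hr
      · exact absurd (Pi.single_eq_of_ne hvr _) hv
    have h3 := rowFactor_mul_closedWalkCount hk hbal hout (s := s) (a := 1)
      (by simp [s]) hr
    rw [if_pos hsupp, ← tau_eq_det_lap hbal] at h3
    refine right_ne_zero_of_mul (h3.trans_ne ?_)
    have h4 : (1 + S.card) * (k - 1) ≠ 0 := Nat.mul_ne_zero (by omega) (by omega)
    have h5 : k - 1 ≠ 0 := by omega
    refine mul_ne_zero (by exact_mod_cast h4) (mul_ne_zero (pow_ne_zero _ (inv_ne_zero ?_)) ?_)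
    · exact_mod_cast h5
    · exact_mod_cast hτ
  have hce : ∀ i : S, ((g i).erase i).card = k - 1 := fun i => by
    rw [card_erase_of_mem (h1 i).1, hcard]
  -- `none` stands for the diagonal entry $r\cdots r$; `some i` for the star at `i`, with the rest
  -- of `g i` listed in increasing order.
  let F : Option S → Fin n × (Fin (k - 1) → Fin n) := fun o =>
    o.elim (r, fun _ => r) fun i => (i, ((g i).erase i).orderEmbOfFin (hce i))
  have hFidx : ∀ i : S, indexSet (F (some i)).1 (F (some i)).2 = g i := by
    intro i
    have : univ.image (((g i).erase i).orderEmbOfFin (hce i)) = (g i).erase i := by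
      rw [← coe_inj, coe_image, coe_univ, Set.image_univ, Finset.range_orderEmbOfFin]
    simp only [F, indexSet, Option.elim_some]
    rw [this, insert_erase (h1 i).1]
  have hFnone : (indexSet (F none).1 (F none).2).card ≠ k := by
    have : indexSet (F none).1 (F none).2 ⊆ {r} := by
      intro x
      simp only [F, indexSet, Option.elim_none, mem_insert, mem_image, mem_univ, true_and,
        mem_singleton]
      rintro (rfl | ⟨_, rfl⟩) <;> rfl
    have := card_le_card this
    rw [card_singleton] at this
    omega
  let ε₀ : Fin (k + 2) ≃ Option S :=
    (Fintype.equivFinOfCardEq (by rw [Fintype.card_option, Fintype.card_coe, hS])).symm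
  -- Sorting by first indices gives the order required of `f` and does not affect its digraph.
  let ε : Fin (k + 2) ≃ Option S := (Tuple.sort fun j => (F (ε₀ j)).1).trans ε₀
  let f : IndexSeq k n (k + 2) := fun j => F (ε j)
  have hdig : digraphOf f = addLoops k (stars Subtype.val g) s := by
    funext u v
    rw [digraphOf_eq_sum, ε.sum_comp fun o =>
      if (F o).1 = u then (univ.filter fun l => (F o).2 l = v).card else 0, Fintype.sum_option,
      add_comm, addLoops]
    congr 1
    · simp only [stars, Finset.card_filter]
      refine Finset.sum_congr rfl fun i _ => ?_
      rw [← Finset.card_filter, card_filter_eq_of_card_indexSet (by omega)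
        (by rw [hFidx]; exact hcard i), hFidx]
      have : (F (some i)).1 = i := rfl
      rw [this]
      by_cases h : (i : Fin n) = u
      · subst h
        simp
      · simp [h]
    · have : F none = (r, fun _ => r) := rfl
      rw [this]
      by_cases hru : r = u
      · subst hru
        by_cases hrv : r = v
        · simp [hrv, s]
        · simp [hrv]
      · simp [hru, s]
  unfold loopFreeDigraphs
  refine mem_image.2 ⟨f, mem_filter.2 ⟨mem_univ _, ?_, ?_, ?_, w, hdig ▸ hw⟩, ?_⟩
  · exact Tuple.monotone_sort fun j => (F (ε₀ j)).1
  · ext v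
    rw [mem_verts_iff (fun v => hdig ▸ hw.outDeg_eq_inDeg v), hdig, outDeg_addLoops, hout]
    by_cases hv : v ∈ S
    · simp only [hv, if_true, iff_true]
      omega
    · have : v ≠ r := fun h => hv (h ▸ hr)
      simp [hv, s, Pi.single_eq_of_ne this]
  · have hsome : ∀ j, (indexSet (f j).1 (f j).2).card = k ↔ ∃ i, ε j = some i := by
      intro j
      change (indexSet (F (ε j)).1 (F (ε j)).2).card = k ↔ _
      cases hj : ε j with
      | none => simpa using hFnone
      | some i => simp only [hFidx, hcard, Option.some.injEq, exists_eq']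
    unfold hyperedgesOf
    refine (Multiset.Nodup.ext (Multiset.Nodup.map_on ?_ (Finset.nodup _)) (Finset.nodup _)).2 ?_
    · intro j hj j' hj' hjj
      obtain ⟨i, hi⟩ := (hsome j).1 (mem_filter.1 (Finset.mem_def.2 hj)).2
      obtain ⟨i', hi'⟩ := (hsome j').1 (mem_filter.1 (Finset.mem_def.2 hj')).2
      have h5 : indexSet (F (ε j)).1 (F (ε j)).2 = indexSet (F (ε j')).1 (F (ε j')).2 := hjj
      rw [hi, hi', hFidx, hFidx] at h5
      apply ε.injective
      rw [hi, hi', injective_of_mem_starFamilies hS hg h5]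
    · intro e
      rw [Finset.mem_val, ← image_of_mem_starFamilies hS hg, mem_image, Multiset.mem_map]
      constructor
      · rintro ⟨j, hj, rfl⟩
        obtain ⟨i, hi⟩ := (hsome j).1 (mem_filter.1 (Finset.mem_def.2 hj)).2
        refine ⟨i, mem_univ _, ?_⟩
        change _ = indexSet (F (ε j)).1 (F (ε j)).2
        rw [hi, hFidx]
      · rintro ⟨i, -, rfl⟩
        refine ⟨ε.symm (some i), Finset.mem_def.1 (mem_filter.2 ⟨mem_univ _, (hsome _).2 ⟨i, ?_⟩⟩), ?_⟩
        · rw [ε.apply_symm_apply]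
        · change indexSet (F (ε _)).1 (F (ε _)).2 = _
          rw [ε.apply_symm_apply, hFidx]
  · rw [hdig, deleteLoops_addLoops_stars]

theorem card_filter_powersetCard {G : Finset (Fin n)} (hG : G.card = k + 1) {v : Fin n}
    (hv : v ∈ G) : ((powersetCard k G).filter fun e => v ∈ e).card = k := by
  have h1 : ((powersetCard k G).filter fun e => v ∉ e) = powersetCard k (G.erase v) := by
    ext e
    simp only [mem_filter, mem_powersetCard, subset_erase]
    tauto
  have h2 := card_filter_add_card_filter_not (s := powersetCard k G) (fun e => v ∈ e)
  rw [h1, card_powersetCard, card_powersetCard, card_erase_of_mem hv, hG, Nat.add_sub_cancel,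
    Nat.choose_self, Nat.choose_succ_self_right] at h2
  omega

/-- Of the $k+2$ entries exactly $k+1$ are hyperedges. Balance modulo $k$ forces the remaining entry
to be diagonal, so it disappears with the loops, and then forces the centres to run through $G$ once
each. -/
theorem exists_starFamily_of_mem_loopFreeDigraphs (hk : 2 ≤ k) {G : Finset (Fin n)}
    (hG : G.card = k + 1) {D : MultiDigraph n} (hD : D ∈ loopFreeDigraphs k G) :
    ∃ g ∈ starFamilies k G, stars Subtype.val g = D := by
  classical
  unfold loopFreeDigraphs at hD
  obtain ⟨f, hf, rfl⟩ := mem_image.1 hD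
  obtain ⟨-, -, -, hH, w, hw⟩ := mem_filter.1 hf
  let J : Finset (Fin (k + 2)) := univ.filter fun j => (indexSet (f j).1 (f j).2).card = k
  let e : Fin (k + 2) → Finset (Fin n) := fun j => indexSet (f j).1 (f j).2
  have hJe : J.val.map e = (powersetCard k G).val := hH
  have hinj : Set.InjOn e J := by
    intro i hi j hj hij
    exact Multiset.inj_on_of_nodup_map (hJe ▸ Finset.nodup _) i hi j hj hij
  have himg : J.image e = powersetCard k G := by
    ext x
    rw [← Finset.mem_val (s := powersetCard k G), ← hJe, mem_image, Multiset.mem_map]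
    simp
  have hJcard : J.card = k + 1 := by
    rw [← card_image_of_injOn hinj, himg, card_powersetCard, hG, Nat.choose_succ_self_right]
  obtain ⟨j₀, hj₀⟩ : ∃ j₀, univ \ J = {j₀} := by
    rw [← card_eq_one, card_sdiff_of_subset (subset_univ _), hJcard, card_univ, Fintype.card_fin]
    omega
  have hek : ∀ j : J, (e j).card = k := fun j => (mem_filter.1 j.2).2
  let c : J → Fin n := fun j => (f j).1
  have hce : ∀ j : J, c j ∈ e j := fun j => mem_insert_self _ _
  have hdig : ∀ u v, digraphOf f u v = stars c (fun j => e j) u v +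
      if (f j₀).1 = u then (univ.filter fun l => (f j₀).2 l = v).card else 0 := by
    intro u v
    rw [digraphOf_eq_sum, ← Finset.sum_sdiff (subset_univ J), hj₀, sum_singleton, add_comm]
    congr 1
    rw [← Finset.sum_coe_sort, stars, Finset.card_filter]
    refine Finset.sum_congr rfl fun j _ => ?_
    rw [card_filter_eq_of_card_indexSet (by omega) (hek j)]
    change (if c j = u then (if v ∈ (e j).erase (c j) then 1 else 0) else 0) = _
    by_cases h : c j = u
    · subst h
      simp
    · simp [h]
  let μ : Fin n → ℕ := fun v => (univ.filter fun l => (f j₀).2 l = v).card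
  have hcount : ∀ v, (univ.filter fun j : J => v ∈ e j).card = if v ∈ G then k else 0 := by
    intro v
    have h1 : (univ.filter fun j : J => v ∈ e j).card = (J.filter fun j => v ∈ e j).card := by
      rw [Finset.card_filter, Finset.sum_coe_sort J fun j => if v ∈ e j then 1 else 0,
        ← Finset.card_filter]
    have h2 : ((powersetCard k G).filter fun x => v ∈ x) = (J.filter fun j => v ∈ e j).image e := by
      rw [← himg, Finset.filter_image]
    rw [h1, ← card_image_of_injOn (hinj.mono (coe_subset.2 (filter_subset _ _))), ← h2]
    split_ifs with hv
    · exact card_filter_powersetCard hG hv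
    · rw [Finset.card_eq_zero, Finset.filter_eq_empty_iff]
      exact fun x hx hvx => hv ((mem_powersetCard.1 hx).1 hvx)
  -- In- and out-degree compared at `v`, with `μ v` the number of arcs that the exceptional entry
  -- sends to `v`.
  have hbal : ∀ v, k * (univ.filter fun j => c j = v).card +
      (if (f j₀).1 = v then k - 1 else 0) = (if v ∈ G then k else 0) + μ v := by
    intro v
    have h1 := hw.outDeg_eq_inDeg v
    have h2 : outDeg (digraphOf f) v = outDeg (stars c fun j => e j) v +
        if (f j₀).1 = v then k - 1 else 0 := by
      simp only [outDeg, hdig, Finset.sum_add_distrib]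
      congr 1
      split_ifs
      · rw [← Finset.card_eq_sum_card_fiberwise (f := (f j₀).2)
          (fun _ _ => mem_coe.2 (mem_univ _)), card_univ, Fintype.card_fin]
      · simp
    have h3 : inDeg (digraphOf f) v = inDeg (stars c fun j => e j) v + μ v := by
      simp only [inDeg, hdig, Finset.sum_add_distrib]
      congr 1
      simp [μ]
    have h4 := inDeg_stars hce v
    rw [h2, h3, outDeg_stars hce hek] at h1
    rw [hcount] at h4
    have h5 : ∀ x, k * x = (k - 1) * x + x := fun x => by
      rw [← Nat.succ_mul, Nat.succ_eq_add_one, Nat.sub_add_cancel (by omega)]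
    rw [h5]
    omega
  have hμle : ∀ v, μ v ≤ k - 1 := fun v => (card_le_univ _).trans (by simp)
  -- Away from the first index of the exceptional entry, `μ v` is a multiple of $k$ that is at most
  -- $k-1$.
  have hμ : ∀ v, v ≠ (f j₀).1 → μ v = 0 := by
    intro v hv
    have h1 := hbal v
    rw [if_neg hv.symm, add_zero] at h1
    have h2 : k ∣ μ v := by
      refine (Nat.dvd_add_right (b := if v ∈ G then k else 0) ?_).1 ⟨_, h1.symm⟩
      split_ifs <;> simp
    exact Nat.eq_zero_of_dvd_of_lt h2 (by have := hμle v; omega)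
  have hμ₀ : μ (f j₀).1 = k - 1 := by
    have : (univ.filter fun l => (f j₀).2 l = (f j₀).1) = univ := by
      rw [Finset.filter_eq_self]
      intro l _
      by_contra h
      have h1 := hμ _ h
      rw [Finset.card_eq_zero, Finset.filter_eq_empty_iff] at h1
      exact h1 (mem_univ l) rfl
    simp only [μ]
    rw [this, card_univ, Fintype.card_fin]
  have hroot : ∀ v, (univ.filter fun j => c j = v).card = if v ∈ G then 1 else 0 := by
    intro v
    have h1 := hbal v
    have h2 : k * (univ.filter fun j => c j = v).card = if v ∈ G then k else 0 := by
      by_cases hv : v = (f j₀).1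
      · subst hv
        rw [if_pos rfl, hμ₀] at h1
        omega
      · rw [if_neg (Ne.symm hv), hμ v hv] at h1
        exact h1
    split_ifs at h2 ⊢ with hv
    · exact Nat.eq_of_mul_eq_mul_left (by omega) (h2.trans (mul_one k).symm)
    · exact (Nat.mul_eq_zero.1 h2).resolve_left (by omega)
  have hcG : ∀ j, c j ∈ G := by
    intro j
    by_contra h
    have := hroot (c j)
    rw [if_neg h, Finset.card_eq_zero, Finset.filter_eq_empty_iff] at this
    exact this (mem_univ j) rfl
  have hbij : Function.Bijective fun j : J => (⟨c j, hcG j⟩ : G) := by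
    constructor
    · intro i j hij
      have hij' : c i = c j := congrArg Subtype.val hij
      have := hroot (c j)
      rw [if_pos (hcG j)] at this
      exact card_le_one.1 this.le i (mem_filter.2 ⟨mem_univ _, hij'⟩) j
        (mem_filter.2 ⟨mem_univ _, rfl⟩)
    · intro v
      have := hroot v
      rw [if_pos v.2] at this
      obtain ⟨j, hj⟩ := card_pos.1 (this ▸ Nat.one_pos)
      exact ⟨j, Subtype.ext (mem_filter.1 hj).2⟩
  let E : J ≃ G := Equiv.ofBijective _ hbij
  have hE : ∀ j, ((E j : G) : Fin n) = c j := fun _ => rfl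
  have hstars : stars Subtype.val (fun i => e (E.symm i)) = stars c fun j => e j := by
    funext u v
    simp only [stars, Finset.card_filter]
    rw [← E.sum_comp]
    simp only [E.symm_apply_apply, hE]
  refine ⟨fun i => e (E.symm i), mem_starFamilies.2 ⟨fun i => ⟨?_, ?_⟩, fun v hv => ?_⟩, ?_⟩
  · have := hce (E.symm i)
    rwa [← hE, E.apply_symm_apply] at this
  · rw [← himg]
    exact mem_image_of_mem _ (E.symm i).2
  · have := hcount v
    rw [if_pos hv] at this
    refine Eq.trans ?_ this
    rw [Finset.card_filter, Finset.card_filter, ← E.sum_comp]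
    simp only [E.symm_apply_apply]
  · rw [hstars]
    funext u v
    unfold deleteLoops
    split_ifs with h
    · rw [h, stars_self]
    · rw [hdig]
      split_ifs with hu
      · have : μ v = 0 := hμ v (by rw [hu]; exact Ne.symm h)
        simp only [μ] at this
        rw [this, add_zero]
      · rw [add_zero]

/-- $R(\mathcal G)$ lies among the digraphs of star families, and a family outside it has no
spanning tree and adds nothing. Balance makes the choice of the root irrelevant. -/
theorem sum_tau_loopFreeDigraphs (hk : 2 ≤ k) {G : Finset (Fin n)} (hG : G.card = k + 1)
    (root : MultiDigraph n → Fin n) (hroot : ∀ D ∈ loopFreeDigraphs k G, root D ∈ G)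
    {r : Fin n} (hr : r ∈ G) :
    ∑ D ∈ loopFreeDigraphs k G, (tau D (root D) : ℂ) =
      ∑ g ∈ starFamilies k G, (lap (stars Subtype.val g) r).det := by
  classical
  have hsub : loopFreeDigraphs k G ⊆ (starFamilies k G).image fun g => stars Subtype.val g := by
    intro D hD
    obtain ⟨g, hg, rfl⟩ := exists_starFamily_of_mem_loopFreeDigraphs hk hG hD
    exact mem_image_of_mem _ hg
  have hdet : ∀ g ∈ starFamilies k G, ∀ v ∈ G, outDeg (stars Subtype.val g) v ≠ 0 := by
    intro g hg v hv
    obtain ⟨h1, -⟩ := mem_starFamilies.1 hg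
    rw [outDeg_stars_coe (fun i => (h1 i).1) (fun i => (mem_powersetCard.1 (h1 i).2).2),
      if_pos hv]
    omega
  have h1 : ∀ D ∈ loopFreeDigraphs k G, (tau D (root D) : ℂ) = (lap D r).det := by
    intro D hD
    obtain ⟨g, hg, rfl⟩ := mem_image.1 (hsub hD)
    have hb := balanced_of_mem_starFamilies (by omega) hg
    rw [tau_eq_det_lap hb]
    exact det_lap_eq_of_balanced hb (hdet g hg _ (hroot _ hD)) (hdet g hg r hr)
  rw [Finset.sum_congr rfl h1, Finset.sum_subset hsub, Finset.sum_image (stars_coe_injOn G)]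
  intro D hD hnot
  obtain ⟨g, hg, rfl⟩ := mem_image.1 hD
  by_contra h
  rw [← tau_eq_det_lap (balanced_of_mem_starFamilies (by omega) hg)] at h
  exact hnot (stars_mem_loopFreeDigraphs hk hG hg hr (by exact_mod_cast h))

end StarFamilies

section Assembly

variable {k n : ℕ}

/-! ### The contributing parts of the trace -/

/-- The weight of a digraph depends on the loops only through the condition that they sit on `S`, so
the sum over the loop exponents factors out. -/
theorem sum_piAntidiag_ite_support (S : Finset (Fin n)) (a : ℕ) (F : (Fin n → ℕ) → ℂ) (c : ℂ) :
    ∑ s ∈ piAntidiag (univ : Finset (Fin n)) a,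
      F s * (if ∀ v, s v ≠ 0 → v ∈ S then c else 0) = (∑ s ∈ piAntidiag S a, F s) * c := by
  have h : piAntidiag S a =
      (piAntidiag (univ : Finset (Fin n)) a).filter fun s => ∀ v, s v ≠ 0 → v ∈ S := by
    ext s
    simp only [mem_filter, mem_piAntidiag, mem_univ, implies_true, and_true]
    refine and_congr_left fun hs => ?_
    rw [Finset.sum_subset (subset_univ S)]
    intro v _ hv
    by_contra h0
    exact hv (hs v h0)
  rw [h, Finset.sum_filter, Finset.sum_mul]
  refine Finset.sum_congr rfl fun s _ => ?_
  split_ifs <;> simp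

/-! ### Complete homogeneous symmetric sums of degrees one and two. -/

theorem prod_pow_single (x : Fin n → ℂ) (i : Fin n) (a : ℕ) :
    ∏ v, x v ^ (Pi.single i a : Fin n → ℕ) v = x i ^ a := by
  rw [Finset.prod_eq_single i]
  · simp
  · intro v _ hv
    simp [Pi.single_eq_of_ne hv]
  · simp

theorem single_injective {a : ℕ} (ha : a ≠ 0) :
    Function.Injective fun i : Fin n => (Pi.single i a : Fin n → ℕ) := by
  intro i j h
  by_contra hij
  have := congrFun h i
  simp only [Pi.single_eq_same, Pi.single_eq_of_ne hij] at this
  exact ha this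

theorem sum_piAntidiag_one (S : Finset (Fin n)) (x : Fin n → ℂ) :
    ∑ s ∈ piAntidiag S 1, ∏ v, x v ^ s v = ∑ i ∈ S, x i := by
  have h : piAntidiag S 1 = S.image fun i => Pi.single i 1 := by
    ext s
    rw [mem_image, mem_piAntidiag]
    constructor
    · rintro ⟨h1, h2⟩
      obtain ⟨i, hi, hi0⟩ := Finset.exists_ne_zero_of_sum_ne_zero (h1.trans_ne one_ne_zero)
      refine ⟨i, hi, ?_⟩
      have h3 : s i + ∑ v ∈ S.erase i, s v = 1 := by rw [Finset.add_sum_erase _ _ hi]; exact h1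
      funext v
      by_cases hv : v = i
      · subst hv
        rw [Pi.single_eq_same]
        omega
      · rw [Pi.single_eq_of_ne hv]
        by_contra hv0
        have := (Finset.sum_eq_zero_iff.1 (show ∑ v ∈ S.erase i, s v = 0 by omega)) v
          (mem_erase.2 ⟨hv, h2 v (Ne.symm hv0)⟩)
        exact hv0 this.symm
    · rintro ⟨i, hi, rfl⟩
      refine ⟨by simp [Finset.sum_pi_single', hi], fun v hv => ?_⟩
      by_cases hvi : v = i
      · exact hvi ▸ hi
      · exact absurd (Pi.single_eq_of_ne hvi _) hv
  rw [h, Finset.sum_image (single_injective one_ne_zero).injOn]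
  simp only [prod_pow_single, pow_one]

theorem sum_piAntidiag_two (S : Finset (Fin n)) (x : Fin n → ℂ) :
    ∑ s ∈ piAntidiag S 2, ∏ v, x v ^ s v =
      (∑ p ∈ S.powersetCard 2, ∏ i ∈ p, x i) + ∑ i ∈ S, x i ^ 2 := by
  have h : piAntidiag S 2 =
      ((S.powersetCard 2).image fun p v => if v ∈ p then 1 else 0) ∪
        S.image fun i => Pi.single i 2 := by
    ext s
    rw [mem_union, mem_image, mem_image, mem_piAntidiag]
    constructor
    · rintro ⟨h1, h2⟩
      have h1' : ∑ v ∈ S, s v = 2 := h1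
      by_cases hs : ∃ i, 2 ≤ s i
      · obtain ⟨i, hi⟩ := hs
        have hiS := h2 i (by omega)
        have h3 : s i + ∑ v ∈ S.erase i, s v = 2 := by
          rw [Finset.add_sum_erase _ _ hiS]; exact h1
        refine Or.inr ⟨i, hiS, ?_⟩
        funext v
        by_cases hv : v = i
        · subst hv
          rw [Pi.single_eq_same]
          omega
        · rw [Pi.single_eq_of_ne hv]
          by_contra hv0
          have := (Finset.sum_eq_zero_iff.1 (show ∑ v ∈ S.erase i, s v = 0 by omega)) v
            (mem_erase.2 ⟨hv, h2 v (Ne.symm hv0)⟩)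
          exact hv0 this.symm
      · push Not at hs
        refine Or.inl ⟨S.filter fun v => s v ≠ 0, mem_powersetCard.2 ⟨filter_subset _ _, ?_⟩, ?_⟩
        · rw [← h1', Finset.card_filter]
          refine Finset.sum_congr rfl fun v _ => ?_
          have := hs v
          split_ifs <;> omega
        · funext v
          have := hs v
          have := h2 v
          by_cases hv : s v = 0
          · simp [hv]
          · rw [if_pos (mem_filter.2 ⟨h2 v hv, hv⟩)]
            omega
    · rintro (⟨p, hp, rfl⟩ | ⟨i, hi, rfl⟩)
      · obtain ⟨hpS, hp2⟩ := mem_powersetCard.1 hp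
        refine ⟨?_, fun v hv => ?_⟩
        · rw [← hp2, Finset.sum_ite_mem, inter_eq_right.2 hpS, Finset.card_eq_sum_ones]
        · by_contra h
          exact hv (if_neg fun h' => h (hpS h'))
      · refine ⟨by simp [Finset.sum_pi_single', hi], fun v hv => ?_⟩
        by_cases hvi : v = i
        · exact hvi ▸ hi
        · exact absurd (Pi.single_eq_of_ne hvi _) hv
  have hdisj : Disjoint ((S.powersetCard 2).image fun p v => if v ∈ p then 1 else 0)
      (S.image fun i => (Pi.single i 2 : Fin n → ℕ)) := by
    rw [Finset.disjoint_left]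
    intro s hs hs'
    obtain ⟨p, -, rfl⟩ := mem_image.1 hs
    obtain ⟨i, -, hi⟩ := mem_image.1 hs'
    have := congrFun hi i
    simp only [Pi.single_eq_same] at this
    split_ifs at this
    all_goals omega
  rw [h, Finset.sum_union hdisj, Finset.sum_image (single_injective two_ne_zero).injOn,
    Finset.sum_image]
  · simp only [prod_pow_single, pow_ite, pow_one, pow_zero, Finset.prod_ite_mem, univ_inter]
  · intro p _ q _ hpq
    ext v
    have := congrFun hpq v
    by_cases h1 : v ∈ p <;> by_cases h2 : v ∈ q <;> simp_all

/-! ### Evaluation of the parts with two and with one diagonal factor. -/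

theorem mul_card_eq_of_mem_piFinset (hk : 1 ≤ k) {H : Hypergraph (Fin n)} (hH : IsUniformOn k H)
    {S : Finset (Fin n)} {g : S → Finset (Fin n)}
    (hg : g ∈ Fintype.piFinset fun j : S => (edges H).filter fun e => (j : Fin n) ∈ e)
    {m : ℕ} {s : Fin n → ℕ} (h : closedWalkCount m (addLoops k (stars Subtype.val g) s) ≠ 0)
    (v : Fin n) : (univ.filter fun j => v ∈ g j).card = if v ∈ S then k else 0 := by
  have hg' := fun j => mem_filter.1 (Fintype.mem_piFinset.1 hg j)
  rw [← mul_card_eq_of_closedWalkCount_ne_zero hk (fun j => (hg' j).2)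
    (fun j => card_of_mem_edges hH (hg' j).1) h v, card_filter_coe_eq]
  split_ifs <;> simp

/-- The part of the trace with two diagonal factors. -/
theorem mixedTrace_two (hk : 2 ≤ k) {H : Hypergraph (Fin n)} (hH : IsUniformOn k H) :
    mixedTrace k H 2 k =
      (((2 + k) * (k - 1) : ℕ) : ℂ) * (((k - 1 : ℕ) : ℂ)⁻¹ ^ k * (k : ℂ) ^ (k - 2)) *
      ∑ e ∈ edges H,
        ((∑ p ∈ e.powersetCard 2, ∏ i ∈ p, (deg H i : ℂ)) + ∑ i ∈ e, (deg H i : ℂ) ^ 2) := by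
  rw [mixedTrace_eq_sum_powersetCard (by omega) hH 2 (show k < 2 * k by omega)]
  have hsub : edges H ⊆ powersetCard k (univ : Finset (Fin n)) := fun e he =>
    mem_powersetCard.2 ⟨subset_univ _, card_of_mem_edges hH he⟩
  -- There are only $k$ stars and each vertex of $S$ must be covered $k$ times, so every chosen
  -- hyperedge contains $S$ and, having $k$ elements, equals it.
  have hconst : ∀ S ∈ powersetCard k (univ : Finset (Fin n)), ∀ s : Fin n → ℕ,
      ∀ g ∈ Fintype.piFinset fun j : S => (edges H).filter fun e => (j : Fin n) ∈ e,
      closedWalkCount ((2 + k) * (k - 1)) (addLoops k (stars Subtype.val g) s) ≠ 0 →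
      ∀ i, g i = S := by
    intro S hS s g hg h i
    have hcard := (mem_powersetCard.1 hS).2
    have hg' := fun j => mem_filter.1 (Fintype.mem_piFinset.1 hg j)
    symm
    refine eq_of_subset_of_card_le (fun v hv => ?_) ?_
    · have h1 := mul_card_eq_of_mem_piFinset (by omega) hH hg h v
      rw [if_pos hv] at h1
      have h2 : (univ.filter fun j => v ∈ g j) = univ := by
        rw [← card_eq_iff_eq_univ, h1, Fintype.card_coe, hcard]
      have h3 : i ∈ univ.filter fun j => v ∈ g j := by
        rw [h2]
        exact mem_univ i
      exact (mem_filter.1 h3).2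
    · rw [card_of_mem_edges hH (hg' i).1, hcard]
  rw [← Finset.sum_subset hsub, Finset.mul_sum]
  · refine Finset.sum_congr rfl fun S hS => ?_
    have hcard := card_of_mem_edges hH hS
    obtain ⟨r, hr⟩ := card_pos.1 (show 0 < S.card by omega)
    rw [← sum_piAntidiag_two, mul_comm _ (∑ s ∈ piAntidiag S 2, _), ← sum_piAntidiag_ite_support]
    refine Finset.sum_congr rfl fun s hs => ?_
    congr 1
    have hsum : ∑ v, s v = 2 := (mem_piAntidiag.1 hs).1
    rw [Finset.sum_eq_single fun _ => S]
    · have hout := outDeg_stars_coe (S := S) (g := fun _ => S) (fun i => i.2) (fun _ => hcard)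
      have hbal : ∀ v, outDeg (stars (Subtype.val : S → Fin n) fun _ => S) v =
          inDeg (stars (Subtype.val : S → Fin n) fun _ => S) v := by
        intro v
        rw [stars_balanced_iff (by omega) (fun i => i.2) (fun _ => hcard), card_filter_coe_eq]
        split_ifs with hv <;> simp [hv, hcard]
      have h1 := rowFactor_mul_closedWalkCount hk hbal hout hsum hr
      have h2 : stars (Subtype.val : S → Fin n) (fun _ => S) =
          fun u v => if u ∈ S ∧ v ∈ S ∧ u ≠ v then 1 else 0 := by
        funext u v
        by_cases hu : u ∈ S
        · rw [show u = ((⟨u, hu⟩ : S) : Fin n) from rfl, stars_coe_apply]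
          simp [hu, and_comm, eq_comm]
        · rw [if_neg fun h => hu h.1, stars, Finset.card_eq_zero, Finset.filter_eq_empty_iff]
          rintro j - ⟨rfl, -⟩
          exact hu j.2
      rw [h2] at h1 ⊢
      rw [det_lap_complete hr (by omega), hcard] at h1
      exact h1
    · intro g hg hne
      by_contra h
      exact hne (funext (hconst S (hsub hS) s g hg (right_ne_zero_of_mul h)))
    · intro hnot
      exact absurd (Fintype.mem_piFinset.2 fun i => mem_filter.2 ⟨hS, i.2⟩) hnot
  · intro S hS hnot
    refine Finset.sum_eq_zero fun s _ => mul_eq_zero_of_right _ (Finset.sum_eq_zero fun g hg => ?_)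
    by_contra h
    have hcard := (mem_powersetCard.1 hS).2
    obtain ⟨r, hr⟩ := card_pos.1 (show 0 < S.card by omega)
    have h1 := hconst S hS s g hg (right_ne_zero_of_mul h) ⟨r, hr⟩
    have h2 := (mem_filter.1 (Fintype.mem_piFinset.1 hg ⟨r, hr⟩)).1
    exact hnot (h1 ▸ h2)

/-- $\binom mk\le1$ for $m\le k$, whereas $\binom{k+2}k>k+1$. -/
theorem card_of_mem_completeSubs (hk : 2 ≤ k) {H : Hypergraph (Fin n)} {G : Finset (Fin n)}
    (hG : G ∈ completeSubs k H) : G.card = k + 1 := by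
  have h := (mem_filter.1 hG).2.2
  rw [card_powersetCard] at h
  rcases lt_trichotomy G.card (k + 1) with h1 | h1 | h1
  · have h2 := Nat.choose_le_choose k (show G.card ≤ k by omega)
    rw [Nat.choose_self] at h2
    omega
  · exact h1
  · have h2 := Nat.choose_le_choose k (show k + 2 ≤ G.card by omega)
    obtain ⟨m, rfl⟩ := Nat.exists_eq_add_of_le' (show 1 ≤ k by omega)
    rw [show m + 1 + 2 = (m + 2) + 1 by omega, Nat.choose_succ_succ' (m + 2) m,
      Nat.choose_succ_self_right] at h2
    have := Nat.choose_pos (show m ≤ m + 2 by omega)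
    omega

/-- The part of the trace with one diagonal factor. -/
theorem mixedTrace_one (hk : 2 ≤ k) {H : Hypergraph (Fin n)} (hH : IsUniformOn k H)
    (root : Finset (Fin n) → MultiDigraph n → Fin n)
    (hroot : ∀ G ∈ completeSubs k H, ∀ D ∈ loopFreeDigraphs k G, root G D ∈ G) :
    mixedTrace k H 1 (k + 1) =
      (((1 + (k + 1)) * (k - 1) : ℕ) : ℂ) * ((k - 1 : ℕ) : ℂ)⁻¹ ^ (k + 1) *
      ∑ G ∈ completeSubs k H,
        (∑ D ∈ loopFreeDigraphs k G, (tau D (root G D) : ℂ)) * ∑ i ∈ G, (deg H i : ℂ) := by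
  rw [mixedTrace_eq_sum_powersetCard (by omega) hH 1 (show k + 1 < 2 * k by omega)]
  have hsub : completeSubs k H ⊆ powersetCard (k + 1) (univ : Finset (Fin n)) := fun G hG =>
    mem_powersetCard.2 ⟨subset_univ _, card_of_mem_completeSubs hk hG⟩
  -- Vertices outside $S$ are not covered at all, so the chosen hyperedges lie inside $S$; those of
  -- $S$ are covered $k$ times.
  have hfam : ∀ (S : Finset (Fin n)) (s : Fin n → ℕ),
      ∀ g ∈ Fintype.piFinset fun j : S => (edges H).filter fun e => (j : Fin n) ∈ e,
      closedWalkCount ((1 + (k + 1)) * (k - 1)) (addLoops k (stars Subtype.val g) s) ≠ 0 →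
      g ∈ starFamilies k S := by
    intro S s g hg h
    have hg' := fun j => mem_filter.1 (Fintype.mem_piFinset.1 hg j)
    have h1 := mul_card_eq_of_mem_piFinset (by omega) hH hg h
    refine mem_starFamilies.2 ⟨fun i => ⟨(hg' i).2, mem_powersetCard.2 ⟨fun v hv => ?_,
      card_of_mem_edges hH (hg' i).1⟩⟩, fun v hv => by rw [h1, if_pos hv]⟩
    by_contra hvS
    have h2 := h1 v
    rw [if_neg hvS, Finset.card_eq_zero, Finset.filter_eq_empty_iff] at h2
    exact h2 (mem_univ i) hv
  rw [← Finset.sum_subset hsub, Finset.mul_sum]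
  · refine Finset.sum_congr rfl fun S hS => ?_
    have hcard := card_of_mem_completeSubs hk hS
    obtain ⟨r, hr⟩ := card_pos.1 (show 0 < S.card by omega)
    have hedges := (mem_filter.1 hS).2.1
    have hsubfam : starFamilies k S ⊆
        Fintype.piFinset fun j : S => (edges H).filter fun e => (j : Fin n) ∈ e := by
      intro g hg
      obtain ⟨h1, -⟩ := mem_starFamilies.1 hg
      exact Fintype.mem_piFinset.2 fun i => mem_filter.2 ⟨hedges (h1 i).2, (h1 i).1⟩
    have hcomm : ∀ x y z : ℂ, x * (y * z) = z * (x * y) := fun x y z => by ring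
    rw [sum_tau_loopFreeDigraphs hk hcard (root S) (hroot S hS) hr, hcomm,
      ← sum_piAntidiag_one, ← sum_piAntidiag_ite_support]
    refine Finset.sum_congr rfl fun s hs => ?_
    congr 1
    have hsum : ∑ v, s v = 1 := (mem_piAntidiag.1 hs).1
    rw [← Finset.sum_subset hsubfam]
    · have hterm : ∀ g ∈ starFamilies k S,
          rowFactor k s (fun v => if v ∈ S then 1 else 0) *
            closedWalkCount ((1 + (k + 1)) * (k - 1)) (addLoops k (stars Subtype.val g) s) =
          if ∀ v, s v ≠ 0 → v ∈ S then
            (((1 + (k + 1)) * (k - 1) : ℕ) : ℂ) * ((k - 1 : ℕ) : ℂ)⁻¹ ^ (k + 1) *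
              (lap (stars Subtype.val g) r).det else 0 := by
        intro g hg
        obtain ⟨h1, -⟩ := mem_starFamilies.1 hg
        have h2 := rowFactor_mul_closedWalkCount hk
          (balanced_of_mem_starFamilies (by omega) hg)
          (outDeg_stars_coe (fun i => (h1 i).1) fun i => (mem_powersetCard.1 (h1 i).2).2) hsum hr
        rw [hcard] at h2
        rw [h2, mul_assoc]
      rw [Finset.sum_congr rfl hterm]
      split_ifs
      · rw [← Finset.mul_sum]
      · rw [Finset.sum_const_zero]
    · intro g hg hnot
      by_contra h
      exact hnot (hfam S s g hg (right_ne_zero_of_mul h))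
  · intro S hS hnot
    refine Finset.sum_eq_zero fun s _ => mul_eq_zero_of_right _ (Finset.sum_eq_zero fun g hg => ?_)
    by_contra h
    have hcard := (mem_powersetCard.1 hS).2
    have h1 := hfam S s g hg (right_ne_zero_of_mul h)
    refine hnot (mem_filter.2 ⟨mem_univ _, ?_, ?_⟩)
    -- A contributing family uses every $k$-subset of $S$, so all of these are hyperedges and $S$
    -- would be a complete subhypergraph.
    · rw [← image_of_mem_starFamilies hcard h1]
      intro e he
      obtain ⟨i, -, rfl⟩ := mem_image.1 he
      exact (mem_filter.1 (Fintype.mem_piFinset.1 hg i)).1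
    · rw [card_powersetCard, hcard, Nat.choose_succ_self_right]

end Assembly

end HyperMoment

/-! ### Assembly of the formula. -/

open HyperMoment in
theorem mainTheorem2 (k n : ℕ) (hk : 2 ≤ k) (α : ℝ) (hα0 : 0 ≤ α) (hα1 : α ≤ 1)
    (H : Hypergraph (Fin n)) (hH : IsUniformOn k H)
    (root : Finset (Fin n) → MultiDigraph n → Fin n)
    (hroot : ∀ G ∈ completeSubs k H, ∀ D ∈ loopFreeDigraphs k G, root G D ∈ G) :
    tensorTrace (k + 2) (alphaTensor k α H) =
      phi k α H (k + 2)
      + (1 - (α : ℂ)) ^ (k + 2) * tensorTrace (k + 2) (adjTensor k H)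
      + ((k : ℂ) + 2) * ((k : ℂ) - 1) ^ ((n : ℤ) - k) * (k : ℂ) ^ (k - 2)
          * (α : ℂ) ^ 2 * (1 - (α : ℂ)) ^ k
          * ∑ e ∈ edges H,
              ((∑ p ∈ e.powersetCard 2, ∏ i ∈ p, (deg H i : ℂ)) + ∑ i ∈ e, (deg H i : ℂ) ^ 2)
      + ((k : ℂ) + 2) * ((k : ℂ) - 1) ^ ((n : ℤ) - k - 1)
          * (α : ℂ) * (1 - (α : ℂ)) ^ (k + 1)
          * ∑ G ∈ completeSubs k H,
              (∑ D ∈ loopFreeDigraphs k G, (tau D (root G D) : ℂ)) * ∑ i ∈ G, (deg H i : ℂ) := by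
  have hk1 : ((k : ℂ) - 1) ≠ 0 := by
    rw [sub_ne_zero]
    exact_mod_cast (show k ≠ 1 by omega)
  have hcast : ((k - 1 : ℕ) : ℂ) = (k : ℂ) - 1 := by
    rw [Nat.cast_sub (by omega), Nat.cast_one]
  -- Integer powers are needed because $n<k$ is possible. The factor $(k-1)$ comes from the number
  -- of arcs $(k+2)(k-1)$, the inverse power from the row factors.
  have hz1 : ((k : ℂ) - 1) ^ ((n : ℤ) - k) =
      ((k : ℂ) - 1) ^ ((n : ℤ) - 1) * (((k : ℂ) - 1) * ((k : ℂ) - 1)⁻¹ ^ k) := by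
    rw [show (n : ℤ) - k = ((n : ℤ) - 1) + (1 + -(k : ℤ)) by ring, zpow_add₀ hk1,
      zpow_add₀ hk1, zpow_one, zpow_neg, zpow_natCast, inv_pow]
  have hz2 : ((k : ℂ) - 1) ^ ((n : ℤ) - k - 1) =
      ((k : ℂ) - 1) ^ ((n : ℤ) - 1) * (((k : ℂ) - 1) * ((k : ℂ) - 1)⁻¹ ^ (k + 1)) := by
    rw [zpow_sub_one₀ hk1, hz1, pow_succ]
    ring
  -- The expansion is indexed by the number $b$ of hyperedge factors: $b=k+2,k+1,k$ are split off,
  -- and of the remaining values only $b=0$ survives.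
  rw [tensorTrace_alphaTensor (by omega) hH, tensorTrace_adjTensor (by omega) hH, phi,
    ← Finset.Nat.sum_antidiagonal_swap, Finset.Nat.sum_antidiagonal_eq_sum_range_succ_mk,
    Finset.sum_range_succ, Finset.sum_range_succ, Finset.sum_range_succ,
    Finset.sum_eq_single_of_mem 0 (Finset.mem_range.2 (by omega)) fun b hb hb0 => by
      rw [Prod.swap_prod_mk, mixedTrace_eq_zero hH _ (Nat.pos_of_ne_zero hb0)
        (Finset.mem_range.1 hb), mul_zero]]
  simp only [Prod.swap_prod_mk, Nat.sub_zero, Nat.sub_self, Nat.add_sub_cancel_left,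
    show k + 2 - (k + 1) = 1 by omega]
  rw [mixedTrace_zero_right hk H (by omega), mixedTrace_two hk hH,
    mixedTrace_one hk hH root hroot, hz1, hz2]
  push_cast
  rw [hcast]
  ring
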